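/- For a set $M\subset\mathbb{R}^d$ let its medial axis $\mathrm{ax}(M)$ be the set of points of $\mathbb{R}^d$ that have two or more closest points on $M$, and let its reach $\rho_M\in[0,\infty]$ be the infimum of the distance between a point of $M$ and $\mathrm{ax}(M)$ (so $\rho_M=\infty$ if $\mathrm{ax}(M)=\emptyset$). Points $x_1,\dots,x_n$ form an $(\varepsilon,1/2)$-net of $M$ if they lie on $M$, every point of $M$ is within distance $\varepsilon$ of some $x_i$, and $\|x_i-x_j\|\ge\varepsilon/2$ for all $i\ne j$. For a submanifold $M$, let $T_M(x)$ denote the tangent space of $M$ at $x\in M$, and let $\angle(T,T')$ denote the maximum principal angle between two subspaces of the same dimension. Proposition. There is a function $C:[0,\infty]\to\mathbb{R}$ such that the following holds for all $d,k,n$, all $\varepsilon$, and all $x_1,\dots,x_n\in\mathbb{R}^d$. Let $\mathbb{S}$ be the class of compact and connected $k$-dimensional $C^2$ submanifolds of $\mathbb{R}^d$ without boundary for which $x_1,\dots,x_n$ is an $(\varepsilon,1/2)$-net, let $M\in\mathbb{S}$, and let $S\in\mathbb{S}$ satisfy $\rho_S\ge\frac12\sup_{S'\in\mathbb{S}}\rho_{S'}$.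 Then, with $C=C(\rho_M)$: 1. the Hausdorff distance between $M$ and $S$ is at most $C\varepsilon^2$; 2. for every $x\in M$ and every closest point $s$ to $x$ on $S$, $\angle(T_M(x),T_S(s))\le C\varepsilon$; 3. for every $a\in S$ and every closest point $m$ to $a$ on $M$, $\angle(T_M(m),T_S(a))\le C\varepsilon$; 4. if $2\varepsilon<\rho_M$, then $M\cap\mathrm{ax}(S)=\emptyset$ and $S\cap\mathrm{ax}(M)=\emptyset$, so that the closest points in 2 and 3 are unique, that is, $s=P_S(x)$ and $m=P_M(a)$ are the metric projections. -/

import Mathlib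

open scoped ENNReal

/-- `M` is an embedded `C²` submanifold of dimension `k`, without boundary, of the normed space `E`:
around each of its points there is a `C²` diffeomorphism between open subsets of `E` which carries
`M` to a `k`-dimensional linear subspace. -/
def IsC2Submanifold {E : Type*} [NormedAddCommGroup E] [NormedSpace ℝ E] (k : ℕ) (M : Set E) :
    Prop :=
  ∀ x ∈ M, ∃ (Φ : OpenPartialHomeomorph E E) (F : Submodule ℝ E),
    x ∈ Φ.source ∧ ContDiffOn ℝ 2 Φ Φ.source ∧ ContDiffOn ℝ 2 Φ.symm Φ.target ∧
      Module.finrank ℝ F = k ∧ ∀ y ∈ Φ.source, y ∈ M ↔ Φ y ∈ F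

/-- The (linear) tangent space of `M` at `x`, spanned by the limits of rescaled secants of `M`
at `x`. For a `C²` submanifold these limits already form a linear subspace. -/
def tangentSpaceAt {E : Type*} [NormedAddCommGroup E] [NormedSpace ℝ E] (M : Set E) (x : E) :
    Submodule ℝ E :=
  Submodule.span ℝ (tangentConeAt ℝ M x)

/-- The maximum principal angle between two subspaces of the same (finite) dimension: the maximum
over nonzero `u ∈ T` of the minimum over `v ∈ T'` of the angle between `u` and `v`.
(The vector `v = 0`, whose angle with every vector is `π / 2`, does not change the minimum when
`T' ≠ 0`.) -/
noncomputable def maxPrincipalAngle {E : Type*} [NormedAddCommGroup E] [InnerProductSpace ℝ E]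
    (T T' : Submodule ℝ E) : ℝ :=
  ⨆ u : {u : E // u ∈ T ∧ u ≠ 0}, ⨅ v : T', InnerProductGeometry.angle (u : E) (v : E)

/-- `p` is a closest point to `z` on `M`. When `z` is outside the medial axis of a nonempty compact
set `M`, there is exactly one such `p`, the metric projection of `z` onto `M`. -/
def IsNearestPoint {E : Type*} [PseudoMetricSpace E] (M : Set E) (z p : E) : Prop :=
  p ∈ M ∧ ∀ q ∈ M, dist z p ≤ dist z q

/-- The medial axis: the points with two or more closest points on `M`. -/
def medialAxis {E : Type*} [PseudoMetricSpace E] (M : Set E) : Set E :=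
  {z | ∃ p q, p ≠ q ∧ IsNearestPoint M z p ∧ IsNearestPoint M z q}

/-- The reach: the infimum of the distance between a point of `M` and the medial axis of `M`
(`∞` if the medial axis is empty). -/
noncomputable def reach {E : Type*} [PseudoMetricSpace E] (M : Set E) : ℝ≥0∞ :=
  ⨅ p ∈ M, ⨅ z ∈ medialAxis M, edist p z

/-- The points `x i` form an `(ε, δ)`-net of `M`: they lie on `M`, every point of `M` is within
distance `ε` of one of them, and they are at distance at least `δ * ε` from one another. -/
def IsNet {E : Type*} [PseudoMetricSpace E] {n : ℕ} (x : Fin n → E) (ε δ : ℝ) (M : Set E) : Prop :=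
  (∀ i, x i ∈ M) ∧ (∀ p ∈ M, ∃ i, dist p (x i) ≤ ε) ∧ ∀ i j, i ≠ j → δ * ε ≤ dist (x i) (x j)

/-- The class of compact and connected `k`-dimensional `C²` submanifolds without boundary for which
the points `x i` form an `(ε, 1/2)`-net. -/
def surfaceClass {E : Type*} [NormedAddCommGroup E] [NormedSpace ℝ E] (k : ℕ) {n : ℕ}
    (x : Fin n → E) (ε : ℝ) : Set (Set E) :=
  {M | IsCompact M ∧ IsConnected M ∧ IsC2Submanifold k M ∧ IsNet x ε (1 / 2) M}

/-- The supremum of the reach over the class of surfaces above. -/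
noncomputable def maxReach {E : Type*} [NormedAddCommGroup E] [NormedSpace ℝ E] (k : ℕ) {n : ℕ}
    (x : Fin n → E) (ε : ℝ) : ℝ≥0∞ :=
  ⨆ M ∈ surfaceClass k x ε, reach M

/-! Since M itself competes in the supremum, ρ_S ≥ ρ_M / 2, so M and S both have reach at least τ =
ρ_M / 2. It remains to compare two submanifolds of reach at least τ that share a net of scale ε.
Closeness of T to T' is measured by the one-sided gap: the least θ with ‖P_{T'ᗮ} u‖ ≤ θ‖u‖ on T.

The geometric input is Federer's theory, derived from uniqueness of closest points. A closest point
within distance τ is touched by an empty ball of radius τ (`IsNearestPoint.inner_le_of_lt_reach`);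
hence a point c of M is within ‖c - a‖² / (2τ) of the affine tangent plane at a
(`IsC2Submanifold.norm_normal_sub_le`), and tangent spaces turn at rate O(1/τ)
(`IsC2Submanifold.norm_normal_tangent_le`).

At a net point x i, each difference x j - x i of length O(ε) is within O(ε²/τ) of both tangent
spaces, and such differences approximate every tangent vector of length 4ε of M up to 2ε. Feeding
this error back into the gap makes it absorbable and gives a gap O(ε/τ)
(`norm_normal_tangent_le_of_net`). Moving along M and S to nearby points gives the angle bounds. For
the Hausdorff bound, a point of M is projected to the tangent space of M at x i, then to that of S,
then lifted to S; each move costs O(ε²/τ). The last claim holds because the net points lie on both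
surfaces: a point of M in ax(S) would force ρ_S ≤ ε < ρ_M / 2. -/

open Filter Topology Set

/-! ### Gaps between subspaces. -/

section LinearAlgebra

variable {E : Type*} [NormedAddCommGroup E] [InnerProductSpace ℝ E] [FiniteDimensional ℝ E]

theorem norm_starProjection_orthogonal_le_norm_sub (T : Submodule ℝ E) (u : E) {v : E}
    (hv : v ∈ T) : ‖Tᗮ.starProjection u‖ ≤ ‖u - v‖ := by
  have h0 : Tᗮ.starProjection v = 0 := by
    rw [Submodule.starProjection_orthogonal_val, Submodule.starProjection_eq_self_iff.2 hv, sub_self]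
  have h : Tᗮ.starProjection u = Tᗮ.starProjection (u - v) := by rw [map_sub, h0, sub_zero]
  rw [h]
  exact Submodule.norm_starProjection_apply_le _ _

theorem norm_starProjection_orthogonal_add_le (T : Submodule ℝ E) (u v : E) :
    ‖Tᗮ.starProjection (u + v)‖ ≤ ‖Tᗮ.starProjection u‖ + ‖Tᗮ.starProjection v‖ := by
  rw [map_add]; exact norm_add_le _ _

theorem norm_starProjection_orthogonal_sub_le (T : Submodule ℝ E) (u v : E) :
    ‖Tᗮ.starProjection (u - v)‖ ≤ ‖Tᗮ.starProjection u‖ + ‖Tᗮ.starProjection v‖ := by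
  rw [map_sub]; exact norm_sub_le _ _

/-- The one-sided gap between subspaces satisfies the triangle inequality. -/
theorem norm_starProjection_orthogonal_trans {B C : Submodule ℝ E} {β : ℝ}
    (hB : ∀ u ∈ B, ‖Cᗮ.starProjection u‖ ≤ β * ‖u‖) (hβ : 0 ≤ β) {u : E} :
    ‖Cᗮ.starProjection u‖ ≤ ‖Bᗮ.starProjection u‖ + β * ‖u‖ := by
  have hu : u = Bᗮ.starProjection u + B.starProjection u := by
    rw [Submodule.starProjection_orthogonal_val]; abel
  calc ‖Cᗮ.starProjection u‖
      = ‖Cᗮ.starProjection (Bᗮ.starProjection u + B.starProjection u)‖ := by rw [← hu]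
    _ ≤ ‖Cᗮ.starProjection (Bᗮ.starProjection u)‖ + ‖Cᗮ.starProjection (B.starProjection u)‖ :=
        norm_starProjection_orthogonal_add_le _ _ _
    _ ≤ ‖Bᗮ.starProjection u‖ + β * ‖u‖ := by
        gcongr
        · exact Submodule.norm_starProjection_apply_le _ _
        · refine (hB _ (Submodule.starProjection_apply_mem _ _)).trans ?_
          gcongr
          exact Submodule.norm_starProjection_apply_le _ _

/-- Between subspaces of the same dimension, the one-sided gap is symmetric. -/
theorem norm_starProjection_orthogonal_symm {A B : Submodule ℝ E}
    (hdim : Module.finrank ℝ A = Module.finrank ℝ B) {θ : ℝ} (hθ : θ < 1)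
    (hA : ∀ u ∈ A, ‖Bᗮ.starProjection u‖ ≤ θ * ‖u‖) {v : E} (hv : v ∈ B) :
    ‖Aᗮ.starProjection v‖ ≤ θ * ‖v‖ := by
  -- A gap below 1 makes the projection A → B injective, hence onto by equality of dimensions, so v
  -- is the projection of some a ∈ A.
  let f : A →ₗ[ℝ] B := (B.orthogonalProjectionOnto : E →ₗ[ℝ] B) ∘ₗ A.subtype
  have hf : ∀ a : A, ((f a : B) : E) = B.starProjection (a : E) := fun a => rfl
  have hinj : Function.Injective f := by
    rw [injective_iff_map_eq_zero]
    intro a ha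
    have h1 : B.starProjection (a : E) = 0 := by rw [← hf, ha]; rfl
    have h2 := hA a a.2
    rw [Submodule.starProjection_orthogonal_val, h1, sub_zero] at h2
    have h3 : ‖(a : E)‖ = 0 := by
      by_contra hne
      have : 0 < ‖(a : E)‖ := lt_of_le_of_ne (norm_nonneg _) (Ne.symm hne)
      nlinarith
    exact Subtype.ext (norm_eq_zero.1 h3)
  obtain ⟨a, ha⟩ := (LinearMap.injective_iff_surjective_of_finrank_eq_finrank hdim).1 hinj ⟨v, hv⟩
  have hav : B.starProjection (a : E) = v := by rw [← hf, ha]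
  have h2 := hA a a.2
  rw [Submodule.starProjection_orthogonal_val, hav] at h2
  have hin : inner ℝ ((a : E) - v) v = 0 := by
    have := Submodule.starProjection_inner_eq_zero (K := B) (a : E) v hv
    rwa [hav] at this
  by_cases ha0 : (a : E) = 0
  · have : v = 0 := by rw [← hav, ha0, map_zero]
    simp [this]
  have hpos : 0 < ‖(a : E)‖ := norm_pos_iff.2 ha0
  -- `t • a` is the foot of the perpendicular from v to the line of a. The triangle 0, v, a has a
  -- right angle at v, so by similarity this perpendicular has length ‖v‖ ‖a - v‖ / ‖a‖.
  set t : ℝ := ‖v‖ ^ 2 / ‖(a : E)‖ ^ 2 with ht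
  refine (norm_starProjection_orthogonal_le_norm_sub A v (A.smul_mem t a.2)).trans ?_
  have hva : inner ℝ v (a : E) = ‖v‖ ^ 2 := by
    rw [inner_sub_left, sub_eq_zero] at hin
    rw [real_inner_comm, hin, real_inner_self_eq_norm_sq]
  have hdist : ‖(a : E) - v‖ ^ 2 = ‖(a : E)‖ ^ 2 - ‖v‖ ^ 2 := by
    rw [norm_sub_sq_real, real_inner_comm, hva]; ring
  have hθ0 : 0 ≤ θ := by
    by_contra hneg
    push Not at hneg
    have := norm_nonneg ((a : E) - v)
    nlinarith
  refine abs_le_of_sq_le_sq' ?_ (by positivity) |>.2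
  rw [norm_sub_sq_real, inner_smul_right, hva, norm_smul, Real.norm_of_nonneg (by positivity)]
  have e : ‖v‖ ^ 2 - 2 * (t * ‖v‖ ^ 2) + (t * ‖(a : E)‖) ^ 2
      = ‖v‖ ^ 2 * (‖(a : E) - v‖ ^ 2 / ‖(a : E)‖ ^ 2) := by
    rw [hdist, ht]; field_simp; ring
  rw [e, mul_pow, mul_comm]
  gcongr
  rw [div_le_iff₀ (by positivity), ← mul_pow]
  gcongr

end LinearAlgebra

/-! ### Tangent spaces and second-order estimates in charts. -/

section Charts

variable {E : Type*} [NormedAddCommGroup E] [NormedSpace ℝ E]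

theorem tangentConeAt_submodule_subset [FiniteDimensional ℝ E] (F : Submodule ℝ E) {x : E} (hx : x ∈ F) :
    tangentConeAt ℝ (F : Set E) x ⊆ F := by
  intro y hy
  obtain ⟨α, l, hl, c, d, -, hd, hc⟩ := exists_fun_of_mem_tangentConeAt hy
  refine F.closed_of_finiteDimensional.mem_of_tendsto hc ?_
  filter_upwards [hd] with a ha
  exact F.smul_mem _ (by simpa using F.sub_mem ha hx)

theorem OpenPartialHomeomorph.hasFDerivAt_of_contDiffOn {Φ : OpenPartialHomeomorph E E}
    (h1 : ContDiffOn ℝ 2 Φ Φ.source) {p : E} (hp : p ∈ Φ.source) :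
    HasFDerivAt Φ (fderiv ℝ Φ p) p :=
  ((h1.contDiffAt (Φ.open_source.mem_nhds hp)).differentiableAt (by norm_num)).hasFDerivAt

theorem OpenPartialHomeomorph.fderiv_symm_comp_fderiv {Φ : OpenPartialHomeomorph E E}
    (h1 : ContDiffOn ℝ 2 Φ Φ.source) (h2 : ContDiffOn ℝ 2 Φ.symm Φ.target) {p : E}
    (hp : p ∈ Φ.source) :
    (fderiv ℝ Φ.symm (Φ p)).comp (fderiv ℝ Φ p) = ContinuousLinearMap.id ℝ E := by
  have hA := OpenPartialHomeomorph.hasFDerivAt_of_contDiffOn h1 hp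
  have hB := OpenPartialHomeomorph.hasFDerivAt_of_contDiffOn (Φ := Φ.symm) h2 (Φ.map_source hp)
  refine (hB.comp p hA).unique ((hasFDerivAt_id p).congr_of_eventuallyEq ?_)
  filter_upwards [Φ.open_source.mem_nhds hp] with y hy
  simp [Φ.left_inv hy]

variable [FiniteDimensional ℝ E]

/-- The derivatives of the chart and of its inverse carry tangent cones to tangent cones, and the
cone of a linear subspace is the subspace itself. This yields the dimension of the tangent space and
curves realizing its vectors. -/
theorem tangentSpaceAt_eq_map {Φ : OpenPartialHomeomorph E E} {F : Submodule ℝ E} {M : Set E}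
    (h1 : ContDiffOn ℝ 2 Φ Φ.source) (h2 : ContDiffOn ℝ 2 Φ.symm Φ.target)
    (hM : ∀ y ∈ Φ.source, y ∈ M ↔ Φ y ∈ F) {p : E} (hp : p ∈ Φ.source) (hpM : p ∈ M) :
    tangentSpaceAt M p = F.map (fderiv ℝ Φ.symm (Φ p) : E →ₗ[ℝ] E) := by
  have hA := OpenPartialHomeomorph.hasFDerivAt_of_contDiffOn h1 hp
  have hB := OpenPartialHomeomorph.hasFDerivAt_of_contDiffOn (Φ := Φ.symm) h2 (Φ.map_source hp)
  have hpF : Φ p ∈ F := (hM p hp).1 hpM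
  apply le_antisymm
  · refine Submodule.span_le.2 fun v hv => ?_
    rw [← tangentConeAt_inter_nhds (Φ.open_source.mem_nhds hp)] at hv
    have h3 := hA.hasFDerivWithinAt.mapsTo_tangent_cone hv
    have h4 := tangentConeAt_submodule_subset F hpF (tangentConeAt_mono (t := (F : Set E)) (by
      rintro _ ⟨y, ⟨hyM, hys⟩, rfl⟩
      exact (hM y hys).1 hyM) h3)
    refine ⟨_, h4, ?_⟩
    exact DFunLike.congr_fun (OpenPartialHomeomorph.fderiv_symm_comp_fderiv h1 h2 hp) v
  · rintro _ ⟨w, hw, rfl⟩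
    refine Submodule.subset_span ?_
    have hwc : w ∈ tangentConeAt ℝ (F : Set E) (Φ p) := by
      have := mem_tangentConeAt_of_segment_subset (s := (F : Set E)) (x := Φ p) (y := Φ p + w)
        (F.convex.segment_subset hpF (F.add_mem hpF hw))
      simpa using this
    rw [← tangentConeAt_inter_nhds (Φ.open_target.mem_nhds (Φ.map_source hp))] at hwc
    have h3 := hB.hasFDerivWithinAt.mapsTo_tangent_cone hwc
    rw [Φ.left_inv hp] at h3
    refine tangentConeAt_mono ?_ h3
    rintro _ ⟨y, ⟨hyF, hyt⟩, rfl⟩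
    rw [hM _ (Φ.map_target hyt), Φ.right_inv hyt]
    exact hyF

theorem IsC2Submanifold.finrank_tangentSpaceAt {k : ℕ} {M : Set E} (h : IsC2Submanifold k M)
    {x : E} (hx : x ∈ M) : Module.finrank ℝ (tangentSpaceAt M x) = k := by
  obtain ⟨Φ, F, hxs, h1, h2, hF, hM⟩ := h x hx
  rw [tangentSpaceAt_eq_map h1 h2 hM hxs hx, ← hF]
  have hcomp := OpenPartialHomeomorph.fderiv_symm_comp_fderiv (Φ := Φ.symm) h2 h1
    (Φ.map_source hxs)
  have hinj : Function.Injective (fderiv ℝ Φ.symm (Φ x) : E →ₗ[ℝ] E) :=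
    Function.LeftInverse.injective (g := fderiv ℝ Φ.symm.symm (Φ.symm (Φ x)))
      fun v => DFunLike.congr_fun hcomp v
  exact (Submodule.equivMapOfInjective _ hinj F).finrank_eq.symm

theorem IsC2Submanifold.exists_curve {k : ℕ} {M : Set E} (h : IsC2Submanifold k M)
    {x : E} (hx : x ∈ M) {v : E} (hv : v ∈ tangentSpaceAt M x) :
    ∃ γ : ℝ → E, γ 0 = x ∧ HasDerivAt γ v 0 ∧ ∀ᶠ t in 𝓝 0, γ t ∈ M := by
  obtain ⟨Φ, F, hxs, h1, h2, -, hM⟩ := h x hx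
  rw [tangentSpaceAt_eq_map h1 h2 hM hxs hx] at hv
  obtain ⟨w, hw, rfl⟩ := hv
  have hB := OpenPartialHomeomorph.hasFDerivAt_of_contDiffOn (Φ := Φ.symm) h2 (Φ.map_source hxs)
  have hl : HasDerivAt (fun t : ℝ => Φ x + t • w) w 0 := by
    simpa using ((hasDerivAt_id (0 : ℝ)).smul_const w).const_add (Φ x)
  refine ⟨fun t => Φ.symm (Φ x + t • w), by simp [Φ.left_inv hxs], ?_, ?_⟩
  · have hB' : HasFDerivAt Φ.symm (fderiv ℝ Φ.symm (Φ x)) (Φ x + (0 : ℝ) • w) := by simpa using hB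
    exact hB'.comp_hasDerivAt (0 : ℝ) hl
  · have : ∀ᶠ t in 𝓝 (0 : ℝ), Φ x + t • w ∈ Φ.target := by
      refine hl.continuousAt.eventually_mem ?_
      simpa using Φ.open_target.mem_nhds (Φ.map_source hxs)
    filter_upwards [this] with t ht
    rw [hM _ (Φ.map_target ht), Φ.right_inv ht]
    exact F.add_mem ((hM x hxs).1 hx) (F.smul_mem _ hw)

/-- Taylor's formula for the inverse chart, whose derivative is locally Lipschitz. The constant K
serves all base points p near x and is not tied to the reach: it gives positivity of the reach and
error terms that vanish in limits. -/
theorem IsC2Submanifold.exists_quadratic_bound {k : ℕ} {M : Set E} (h : IsC2Submanifold k M)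
    {x : E} (hx : x ∈ M) :
    ∃ K > 0, ∃ r > 0, ∀ p ∈ M, ∀ q ∈ M, dist p x < r → dist q x < r →
      ∃ v ∈ tangentSpaceAt M p, ‖q - p - v‖ ≤ K * ‖q - p‖ ^ 2 := by
  obtain ⟨Φ, F, hxs, h1, h2, -, hM⟩ := h x hx
  have hxt := Φ.map_source hxs
  have hc2 : ContDiffAt ℝ 2 Φ.symm (Φ x) := h2.contDiffAt (Φ.open_target.mem_nhds hxt)
  have hc1 : ContDiffAt ℝ 2 Φ x := h1.contDiffAt (Φ.open_source.mem_nhds hxs)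
  obtain ⟨K₁, t₁, ht₁, hK₁⟩ :=
    (hc2.fderiv_right (m := 1) (by norm_num)).exists_lipschitzOnWith
  obtain ⟨K₂, t₂, ht₂, hK₂⟩ := (hc1.of_le (m := 1) (by norm_num)).exists_lipschitzOnWith
  obtain ⟨ρ, hρ, hρt⟩ := Metric.mem_nhds_iff.1
    (Filter.inter_mem ht₁ (Φ.open_target.mem_nhds hxt))
  obtain ⟨r, hr, hrt⟩ := Metric.mem_nhds_iff.1
    (Filter.inter_mem (Filter.inter_mem ht₂ (Φ.open_source.mem_nhds hxs))
      (hc1.continuousAt (Metric.ball_mem_nhds (Φ x) hρ)))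
  refine ⟨K₁ * K₂ ^ 2 + 1, by positivity, r, hr, fun p hp q hq hpr hqr => ?_⟩
  obtain ⟨⟨hp2, hps⟩, hpρ⟩ := hrt (Metric.mem_ball.2 hpr)
  obtain ⟨⟨hq2, hqs⟩, hqρ⟩ := hrt (Metric.mem_ball.2 hqr)
  rw [tangentSpaceAt_eq_map h1 h2 hM hps hp]
  refine ⟨fderiv ℝ Φ.symm (Φ p) (Φ q - Φ p), ⟨_, F.sub_mem ((hM q hqs).1 hq) ((hM p hps).1 hp),
    rfl⟩, ?_⟩
  -- On this convex set the derivative differs from its value at Φ p by at most K₁ ‖Φ q - Φ p‖, as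
  -- the mean value inequality requires.
  set s := Metric.ball (Φ x) ρ ∩ Metric.closedBall (Φ p) ‖Φ q - Φ p‖ with hs
  have key := Convex.norm_image_sub_le_of_norm_hasFDerivWithin_le' (f := Φ.symm)
    (f' := fun y => fderiv ℝ Φ.symm y) (s := s) (x := Φ p) (y := Φ q)
    (φ := fderiv ℝ Φ.symm (Φ p)) (C := K₁ * ‖Φ q - Φ p‖)
    (fun y hy => (OpenPartialHomeomorph.hasFDerivAt_of_contDiffOn (Φ := Φ.symm) h2
      (hρt hy.1).2).hasFDerivWithinAt)
    (fun y hy => by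
      rw [← dist_eq_norm]
      refine (hK₁.dist_le_mul y (hρt hy.1).1 (Φ p) (hρt hpρ).1).trans ?_
      gcongr
      exact hy.2)
    ((convex_ball _ _).inter (convex_closedBall _ _))
    ⟨hpρ, Metric.mem_closedBall_self (norm_nonneg _)⟩
    ⟨hqρ, by rw [Metric.mem_closedBall, dist_eq_norm]⟩
  rw [Φ.left_inv hps, Φ.left_inv hqs] at key
  have hlip : ‖Φ q - Φ p‖ ≤ K₂ * ‖q - p‖ := by
    rw [← dist_eq_norm, ← dist_eq_norm]
    exact hK₂.dist_le_mul q hq2 p hp2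
  calc _ ≤ K₁ * ‖Φ q - Φ p‖ * ‖Φ q - Φ p‖ := key
    _ ≤ K₁ * (K₂ * ‖q - p‖) * (K₂ * ‖q - p‖) := by gcongr
    _ ≤ (K₁ * K₂ ^ 2 + 1) * ‖q - p‖ ^ 2 := by nlinarith [sq_nonneg ‖q - p‖]

end Charts

/-! ### Local graphs over the tangent space, and normality at closest points. -/

section InnerProduct

variable {E : Type*} [NormedAddCommGroup E] [InnerProductSpace ℝ E] [FiniteDimensional ℝ E]

/-- Near `x`, the orthogonal projection to the tangent space at `x` maps `M` onto a
neighbourhood. -/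
theorem IsC2Submanifold.exists_mem_of_small_tangent {k : ℕ} {M : Set E} (h : IsC2Submanifold k M)
    {x : E} (hx : x ∈ M) {r : ℝ} (hr : 0 < r) :
    ∃ R > 0, ∀ u ∈ tangentSpaceAt M x, ‖u‖ < R →
      ∃ q ∈ M, dist q x < r ∧ (tangentSpaceAt M x).starProjection (q - x) = u := by
  obtain ⟨Φ, F, hxs, h1, h2, -, hM⟩ := h x hx
  have hxt := Φ.map_source hxs
  set T := tangentSpaceAt M x with hT
  have hTB := tangentSpaceAt_eq_map h1 h2 hM hxs hx
  set B := fderiv ℝ Φ.symm (Φ x) with hB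
  have hstrict : HasStrictFDerivAt Φ.symm B (Φ x + ((0 : F) : E)) := by
    simpa using (h2.contDiffAt (Φ.open_target.mem_nhds hxt)).hasStrictFDerivAt (by norm_num)
  have hin : HasStrictFDerivAt (fun w : F => Φ x + (w : E)) F.subtypeL 0 :=
    F.subtypeL.hasStrictFDerivAt.const_add _
  have hc : HasStrictFDerivAt (fun w : F => Φ.symm (Φ x + (w : E))) (B.comp F.subtypeL) 0 :=
    HasStrictFDerivAt.comp (f := fun w : F => Φ x + (w : E)) 0 hstrict hin
  have hg : HasStrictFDerivAt
      (fun w : F => T.orthogonalProjectionOnto (Φ.symm (Φ x + (w : E)) - x))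
      (T.orthogonalProjectionOnto.comp (B.comp F.subtypeL)) 0 :=
    T.orthogonalProjectionOnto.hasStrictFDerivAt.comp 0 (hc.sub_const x)
  -- The derivative at 0 of this map F → T is onto, so the map sends neighbourhoods of 0 to
  -- neighbourhoods of 0.
  have hsurj : (T.orthogonalProjectionOnto.comp (B.comp F.subtypeL) : F →L[ℝ] T).range = ⊤ := by
    refine LinearMap.range_eq_top.2 fun v => ?_
    have hv : (v : E) ∈ F.map (B : E →ₗ[ℝ] E) := hTB ▸ v.2
    obtain ⟨w, hw, hwv⟩ := hv
    refine ⟨⟨w, hw⟩, ?_⟩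
    change T.orthogonalProjectionOnto ((B : E →ₗ[ℝ] E) w) = v
    rw [hwv]
    simp
  have hmap := hg.map_nhds_eq_of_surj hsurj
  have hnear : {w : F | Φ x + (w : E) ∈ Φ.target ∧ dist (Φ.symm (Φ x + (w : E))) x < r} ∈ 𝓝 0 := by
    refine Filter.inter_mem ?_ ?_
    · exact hin.continuousAt.eventually_mem (by simpa using Φ.open_target.mem_nhds hxt)
    · have := hc.continuousAt.eventually_mem (Metric.ball_mem_nhds _ hr)
      filter_upwards [this] with w hw
      exact Metric.mem_ball.1 (by simpa [Φ.left_inv hxs] using hw)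
  have himg := Filter.image_mem_map (m := fun w : F =>
    T.orthogonalProjectionOnto (Φ.symm (Φ x + (w : E)) - x)) hnear
  rw [hmap] at himg
  simp only [ZeroMemClass.coe_zero, add_zero, Φ.left_inv hxs, sub_self, map_zero] at himg
  obtain ⟨R, hR, hRs⟩ := Metric.mem_nhds_iff.1 himg
  refine ⟨R, hR, fun u hu huR => ?_⟩
  obtain ⟨w, ⟨hwt, hwr⟩, hwu⟩ := hRs (show (⟨u, hu⟩ : T) ∈ Metric.ball 0 R by simpa using huR)
  refine ⟨_, ?_, hwr, ?_⟩
  · rw [hM _ (Φ.map_target hwt), Φ.right_inv hwt]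
    exact F.add_mem ((hM x hxs).1 hx) w.2
  · rw [Submodule.starProjection_apply]
    exact congrArg Subtype.val hwu

/-- The segment from a point to a closest point of a submanifold is normal to the submanifold. -/
theorem IsC2Submanifold.inner_eq_zero_of_isNearestPoint {k : ℕ} {M : Set E}
    (h : IsC2Submanifold k M) {z p : E} (hp : IsNearestPoint M z p) {v : E}
    (hv : v ∈ tangentSpaceAt M p) : inner ℝ (z - p) v = 0 := by
  obtain ⟨γ, hγ0, hγ, hγM⟩ := h.exists_curve hp.1 hv
  have hmin : IsLocalMin (fun t => ‖z - γ t‖ ^ 2) 0 := by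
    filter_upwards [hγM] with t ht
    have := hp.2 _ ht
    rw [dist_eq_norm, dist_eq_norm] at this
    simp only [hγ0]
    gcongr
  have hder := (hγ.const_sub z).norm_sq
  have h0 := hmin.hasDerivAt_eq_zero hder
  rw [hγ0, inner_neg_right] at h0
  linarith

theorem IsC2Submanifold.starProjection_orthogonal_of_isNearestPoint {k : ℕ} {M : Set E}
    (h : IsC2Submanifold k M) {z p : E} (hp : IsNearestPoint M z p) :
    (tangentSpaceAt M p)ᗮ.starProjection (z - p) = z - p := by
  rw [Submodule.starProjection_eq_self_iff, Submodule.mem_orthogonal']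
  exact fun v hv => h.inner_eq_zero_of_isNearestPoint hp hv

end InnerProduct

/-! ### Closest points and the reach in metric spaces. -/

section NearestPoint

variable {X : Type*} [PseudoMetricSpace X] {M : Set X}

theorem IsCompact.exists_isNearestPoint (hM : IsCompact M) (hne : M.Nonempty) (z : X) :
    ∃ p, IsNearestPoint M z p := by
  obtain ⟨p, hp, hd⟩ := hM.exists_infDist_eq_dist hne z
  exact ⟨p, hp, fun q hq => hd ▸ Metric.infDist_le_dist_of_mem hq⟩

theorem IsNearestPoint.dist_eq_infDist {z p : X} (h : IsNearestPoint M z p) :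
    dist z p = Metric.infDist z M :=
  le_antisymm ((Metric.le_infDist ⟨p, h.1⟩).2 fun {q} hq => h.2 q hq)
    (Metric.infDist_le_dist_of_mem h.1)

theorem reach_le_of_mem_medialAxis {z p : X} (hp : p ∈ M) (hz : z ∈ medialAxis M) :
    reach M ≤ ENNReal.ofReal (dist p z) := by
  rw [← edist_dist]
  exact iInf₂_le_of_le p hp (iInf₂_le z hz)

theorem IsNearestPoint.eq_of_lt_reach {τ : ℝ} (hτ : ENNReal.ofReal τ ≤ reach M) {z p q : X}
    (hp : IsNearestPoint M z p) (hq : IsNearestPoint M z q) (hlt : dist z p < τ) : p = q := by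
  by_contra hne
  have h1 := hτ.trans (reach_le_of_mem_medialAxis hp.1 ⟨p, q, hne, hp, hq⟩)
  rw [dist_comm] at h1
  exact absurd h1 (not_le.2 ((ENNReal.ofReal_lt_ofReal_iff (dist_nonneg.trans_lt hlt)).2 hlt))

end NearestPoint

/-! ### Federer's inequality from uniqueness of closest points. -/

section Reach

variable {E : Type*} [NormedAddCommGroup E] [InnerProductSpace ℝ E] {M : Set E}

/-- A compact `C²` submanifold has positive reach. -/
theorem IsC2Submanifold.reach_pos [FiniteDimensional ℝ E] {k : ℕ} (h : IsC2Submanifold k M)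
    (hM : IsCompact M) : 0 < reach M := by
  have key : ∃ c > 0, ∀ a ∈ M, ∀ z b, a ≠ b → IsNearestPoint M z a → IsNearestPoint M z b →
      c ≤ dist z a := by
    refine hM.induction_on (p := fun s => ∃ c > 0, ∀ a ∈ s, ∀ z b, a ≠ b →
      IsNearestPoint M z a → IsNearestPoint M z b → c ≤ dist z a) ⟨1, one_pos, by simp⟩ ?_ ?_ ?_
    · rintro s t hst ⟨c, hc, H⟩
      exact ⟨c, hc, fun a ha => H a (hst ha)⟩
    · rintro s t ⟨c, hc, H⟩ ⟨c', hc', H'⟩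
      refine ⟨min c c', lt_min hc hc', fun a ha z b hab h1 h2 => ?_⟩
      rcases ha with ha | ha
      · exact (min_le_left _ _).trans (H a ha z b hab h1 h2)
      · exact (min_le_right _ _).trans (H' a ha z b hab h1 h2)
    · intro x hx
      obtain ⟨K, hK, r, hr, H⟩ := h.exists_quadratic_bound hx
      refine ⟨Metric.ball x (r / 2), mem_nhdsWithin_of_mem_nhds
        (Metric.ball_mem_nhds _ (by positivity)), min (r / 4) (1 / (2 * K)),
        lt_min (by positivity) (by positivity), fun a ha z b hab h1 h2 => ?_⟩
      by_contra! hlt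
      obtain ⟨hlt1, hlt2⟩ := lt_min_iff.1 hlt
      have heq : dist z a = dist z b := by rw [h1.dist_eq_infDist, h2.dist_eq_infDist]
      have hax : dist a x < r / 2 := ha
      have hbx : dist b x < r := by
        have t1 := dist_triangle b z x
        have t2 := dist_triangle z a x
        rw [dist_comm b z] at t1
        linarith
      obtain ⟨v, hv, hvb⟩ := H a h1.1 b h2.1 (by linarith) hbx
      have hperp := h.inner_eq_zero_of_isNearestPoint h1 hv
      rw [dist_eq_norm] at heq hlt2
      rw [dist_eq_norm] at heq
      -- Equal distances give ‖b - a‖² = 2⟨z - a, b - a⟩. As z - a is normal at a, the right side is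
      -- at most 2K ‖z - a‖ ‖b - a‖², which is too small when ‖z - a‖ < 1/(2K).
      have e1 : ‖z - b‖ ^ 2 = ‖z - a‖ ^ 2 - 2 * inner ℝ (z - a) (b - a) + ‖b - a‖ ^ 2 := by
        rw [← norm_sub_sq_real]; congr 2; abel
      rw [← heq] at e1
      have e2 : inner ℝ (z - a) (b - a) = inner ℝ (z - a) (b - a - v) := by
        rw [inner_sub_right _ (b - a), hperp, sub_zero]
      have e3 := real_inner_le_norm (z - a) (b - a - v)
      have hpos : 0 < ‖b - a‖ := norm_pos_iff.2 (sub_ne_zero.2 (Ne.symm hab))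
      have e4 : ‖z - a‖ * ‖b - a - v‖ ≤ ‖z - a‖ * (K * ‖b - a‖ ^ 2) := by gcongr
      have e5 : ‖z - a‖ * (2 * K) < 1 := by rwa [lt_div_iff₀ (by positivity)] at hlt2
      have : ‖b - a‖ ^ 2 * (‖z - a‖ * (2 * K)) < ‖b - a‖ ^ 2 * 1 := by gcongr
      nlinarith
  obtain ⟨c, hc, H⟩ := key
  refine (ENNReal.ofReal_pos.2 hc).trans_le (le_iInf₂ fun p hp => le_iInf₂ fun z hz => ?_)
  obtain ⟨a, b, hab, h1, h2⟩ := hz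
  rw [edist_dist, dist_comm]
  exact ENNReal.ofReal_le_ofReal ((H a h1.1 z b hab h1 h2).trans (h1.2 p hp))

/-- The distance to a compact set grows at unit speed away from a unique closest point. -/
theorem IsNearestPoint.exists_le_dist_add_smul (hM : IsCompact M) {z b : E}
    (hb : IsNearestPoint M z b) (hu : ∀ c, IsNearestPoint M z c → c = b) (hpos : 0 < ‖z - b‖)
    {η : ℝ} (hη : 0 < η) (hη1 : η < 1) :
    ∃ t₀ > 0, ∀ t, 0 < t → t ≤ t₀ → ∀ c ∈ M,
      ‖z - b‖ + (1 - η) * t ≤ ‖z + t • (‖z - b‖⁻¹ • (z - b)) - c‖ := by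
  set δ := ‖z - b‖ with hδ
  set ν := δ⁻¹ • (z - b) with hν
  have hν1 : ‖ν‖ = 1 := by
    rw [hν, norm_smul, norm_inv, Real.norm_of_nonneg hpos.le, ← hδ, inv_mul_cancel₀ hpos.ne']
  have hνz : inner ℝ ν (z - b) = δ := by
    rw [hν, inner_smul_left, real_inner_self_eq_norm_sq, ← hδ]
    simp only [conj_trivial]; field_simp
  -- Points c seen from z nearly in the direction of b recede at rate at least 1 - η.
  have hfar : ∀ t, 0 < t → ∀ c ∈ M, (1 - η) * δ ≤ inner ℝ ν (z - c) →
      δ + (1 - η) * t ≤ ‖z + t • ν - c‖ := by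
    intro t ht c hc hin
    have h1 : δ ≤ ‖z - c‖ := by simpa [dist_eq_norm] using hb.2 c hc
    refine abs_le_of_sq_le_sq' ?_ (norm_nonneg _) |>.2
    have e : z + t • ν - c = (z - c) + t • ν := by abel
    rw [e, norm_add_sq_real, inner_smul_right, norm_smul, hν1, real_inner_comm,
      Real.norm_of_nonneg ht.le]
    have h2 : δ ^ 2 ≤ ‖z - c‖ ^ 2 := by gcongr
    have h3 : t * ((1 - η) * δ) ≤ t * inner ℝ ν (z - c) := by gcongr
    have h4 : (1 - η) ^ 2 ≤ 1 := by nlinarith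
    nlinarith [sq_nonneg t]
  -- The other points of M form a compact set that avoids the unique closest point b, so they are
  -- farther than δ by a fixed margin. A move by at most half that margin keeps them far enough.
  set K := M ∩ {c | inner ℝ ν (z - c) ≤ (1 - η) * δ} with hK
  have hKc : IsCompact K := hM.inter_right
    (isClosed_le (continuous_const.inner (continuous_const.sub continuous_id)) continuous_const)
  have hcase : ∀ t, 0 < t → (∀ c ∈ K, δ + t ≤ ‖z + t • ν - c‖) → ∀ c ∈ M,
      δ + (1 - η) * t ≤ ‖z + t • ν - c‖ := by
    intro t ht H c hc
    rcases le_total ((1 - η) * δ) (inner ℝ ν (z - c)) with hin | hin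
    · exact hfar t ht c hc hin
    · refine le_trans ?_ (H c ⟨hc, hin⟩)
      nlinarith
  rcases K.eq_empty_or_nonempty with hKe | hKne
  · exact ⟨1, one_pos, fun t ht _ => hcase t ht (by simp [hKe])⟩
  · obtain ⟨c₀, hc₀⟩ := hKc.exists_isNearestPoint hKne z
    have hlt : δ < ‖z - c₀‖ := by
      have h1 : δ ≤ ‖z - c₀‖ := by simpa [dist_eq_norm] using hb.2 c₀ hc₀.1.1
      refine lt_of_le_of_ne h1 fun heq => ?_
      have : c₀ = b := hu c₀ ⟨hc₀.1.1, fun q hq => by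
        rw [dist_eq_norm, ← heq]; simpa [dist_eq_norm] using hb.2 q hq⟩
      have h2 := hc₀.1.2
      rw [this, mem_ofPred_eq, hνz] at h2
      nlinarith
    refine ⟨(‖z - c₀‖ - δ) / 2, by linarith, fun t ht ht' => hcase t ht fun c hc => ?_⟩
    have h1 : ‖z - c₀‖ ≤ ‖z - c‖ := by simpa [dist_eq_norm] using hc₀.2 c hc
    have h2 : ‖z - c‖ ≤ ‖z + t • ν - c‖ + t := by
      have : z - c = (z + t • ν - c) - t • ν := by abel
      rw [this]
      refine (norm_sub_le _ _).trans ?_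
      rw [norm_smul, hν1, Real.norm_of_nonneg ht.le, mul_one]
    linarith

/-- Inside the reach, the distance to `M` increases by almost `s` in the ball of radius `s`. -/
theorem exists_le_infDist_of_lt_reach [FiniteDimensional ℝ E] (hM : IsCompact M) {τ : ℝ}
    (hτ : ENNReal.ofReal τ ≤ reach M) {z b : E} (hb : IsNearestPoint M z b) (hpos : 0 < ‖z - b‖)
    {s : ℝ} (hs : 0 < s) (hsτ : ‖z - b‖ + s < τ) {η : ℝ} (hη : 0 < η) (hη1 : η < 1) :
    ∃ w ∈ Metric.closedBall z s, ‖z - b‖ + (1 - η) * s ≤ Metric.infDist w M := by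
  have hne : M.Nonempty := ⟨b, hb.1⟩
  have hδ : ‖z - b‖ = Metric.infDist z M := by rw [← hb.dist_eq_infDist, dist_eq_norm]
  -- The penalized distance cannot be maximal inside the ball: there, moving away from the unique
  -- closest point gains at rate 1 - η/2 and pays at most 1 - η. So the maximizer lies on the
  -- sphere, and no gradient flow is needed.
  obtain ⟨w, hw, hmax⟩ := (isCompact_closedBall z s).exists_isMaxOn
    ⟨z, Metric.mem_closedBall_self hs.le⟩
    (f := fun w => Metric.infDist w M - (1 - η) * dist w z)
    (by fun_prop)
  have hmax' : ∀ y ∈ Metric.closedBall z s, Metric.infDist y M - (1 - η) * dist y z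
      ≤ Metric.infDist w M - (1 - η) * dist w z := fun y hy => hmax hy
  have h0 := hmax' z (Metric.mem_closedBall_self hs.le)
  rw [dist_self, mul_zero, sub_zero, ← hδ] at h0
  refine ⟨w, hw, ?_⟩
  rcases (Metric.mem_closedBall.1 hw).lt_or_eq with hlt | heq
  · exfalso
    obtain ⟨a, ha⟩ := hM.exists_isNearestPoint hne w
    have hwa : ‖w - a‖ = Metric.infDist w M := by rw [← ha.dist_eq_infDist, dist_eq_norm]
    have hwpos : 0 < ‖w - a‖ := by
      rw [hwa]
      nlinarith [dist_nonneg (x := w) (y := z)]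
    have hwτ : ‖w - a‖ < τ := by
      have := Metric.infDist_le_infDist_add_dist (s := M) (x := w) (y := z)
      rw [hwa]; linarith
    have huniq : ∀ c, IsNearestPoint M w c → c = a := fun c hc =>
      (ha.eq_of_lt_reach hτ hc (by rwa [dist_eq_norm])).symm
    obtain ⟨t₀, ht₀, H⟩ := ha.exists_le_dist_add_smul hM huniq hwpos (half_pos hη) (by linarith)
    set ν := ‖w - a‖⁻¹ • (w - a) with hν
    have hν1 : ‖ν‖ = 1 := by
      rw [hν, norm_smul, norm_inv, norm_norm, inv_mul_cancel₀ hwpos.ne']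
    set t := min t₀ (s - dist w z) with ht
    have htpos : 0 < t := lt_min ht₀ (by linarith)
    have hdist : dist (w + t • ν) z ≤ dist w z + t := by
      refine (dist_triangle _ w _).trans ?_
      rw [dist_eq_norm (w + t • ν), add_sub_cancel_left, norm_smul, hν1,
        Real.norm_of_nonneg htpos.le]
      linarith
    have h1 := hmax' (w + t • ν) (Metric.mem_closedBall.2
      (hdist.trans (by linarith [min_le_right t₀ (s - dist w z)])))
    have h2 : ‖w - a‖ + (1 - η / 2) * t ≤ Metric.infDist (w + t • ν) M :=
      (Metric.le_infDist hne).2 fun {c} hc => by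
        rw [dist_eq_norm]; exact H t htpos (min_le_left _ _) c hc
    rw [hwa] at h2
    have h3 : (1 - η) * dist (w + t • ν) z ≤ (1 - η) * (dist w z + t) :=
      mul_le_mul_of_nonneg_left hdist (by linarith)
    nlinarith
  · rw [heq] at h0; linarith

/-- Inside the reach, a closest point remains closest when moving away from it. -/
theorem IsNearestPoint.le_norm_add_smul_sub [FiniteDimensional ℝ E] (hM : IsCompact M) {τ : ℝ}
    (hτ : ENNReal.ofReal τ ≤ reach M) {z b : E} (hb : IsNearestPoint M z b) (hpos : 0 < ‖z - b‖)
    {s : ℝ} (hs : 0 < s) (hsτ : ‖z - b‖ + s < τ) {c : E} (hc : c ∈ M) :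
    ‖z - b‖ + s ≤ ‖z + s • (‖z - b‖⁻¹ • (z - b)) - c‖ := by
  obtain ⟨w, hw, hmax⟩ := (isCompact_closedBall z s).exists_isMaxOn
    ⟨z, Metric.mem_closedBall_self hs.le⟩ (f := fun w => Metric.infDist w M) (by fun_prop)
  set δ := ‖z - b‖ with hδ
  have h1 : δ + s ≤ Metric.infDist w M := by
    refine le_of_forall_pos_le_add fun e he => ?_
    set η := min (1 / 2) (e / s) with hη
    have hη0 : 0 < η := lt_min (by norm_num) (by positivity)
    obtain ⟨y, hy, hyd⟩ := exists_le_infDist_of_lt_reach hM hτ hb hpos hs hsτ hη0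
      ((min_le_left _ _).trans_lt (by norm_num))
    have h2 : Metric.infDist y M ≤ Metric.infDist w M := hmax hy
    have h3 : η * s ≤ e := by
      rw [← le_div_iff₀ hs]; exact min_le_right _ _
    linarith
  have hwb : δ + s ≤ ‖w - b‖ := by
    rw [← dist_eq_norm]; exact h1.trans (Metric.infDist_le_dist_of_mem hb.1)
  have hwz : ‖w - z‖ ≤ s := by rw [← dist_eq_norm]; exact hw
  set ν := δ⁻¹ • (z - b) with hν
  have hzb : z - b = δ • ν := by rw [hν, smul_smul, mul_inv_cancel₀ hpos.ne', one_smul]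
  have hν1 : ‖ν‖ = 1 := by
    rw [hν, norm_smul, norm_inv, Real.norm_of_nonneg hpos.le, ← hδ, inv_mul_cancel₀ hpos.ne']
  -- w is within s of z yet at distance at least δ + s from b. Equality in the triangle inequality
  -- forces w = z + s ν.
  have hsq : (δ + s) ^ 2 ≤ ‖w - z‖ ^ 2 + 2 * (δ * inner ℝ (w - z) ν) + δ ^ 2 := by
    have e : w - b = (w - z) + (z - b) := by abel
    have : (δ + s) ^ 2 ≤ ‖w - b‖ ^ 2 := by gcongr
    rwa [e, norm_add_sq_real, ← hδ, hzb, inner_smul_right] at this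
  have hwz2 : ‖w - z‖ ^ 2 ≤ s ^ 2 := by gcongr
  have hin : s ≤ inner ℝ (w - z) ν := by
    have : δ * s ≤ δ * inner ℝ (w - z) ν := by nlinarith
    exact le_of_mul_le_mul_left this hpos
  have hz0 : ‖w - z - s • ν‖ ^ 2 ≤ 0 := by
    rw [norm_sub_sq_real, inner_smul_right, norm_smul, hν1, Real.norm_of_nonneg hs.le]
    nlinarith
  have hw' : w = z + s • ν := by
    have : w - z - s • ν = 0 := by
      rw [← norm_eq_zero]
      exact pow_eq_zero_iff two_ne_zero |>.1 (le_antisymm hz0 (sq_nonneg _))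
    rw [sub_eq_zero, sub_eq_iff_eq_add] at this
    rw [this, add_comm]
  rw [← hw', ← dist_eq_norm]
  exact h1.trans (Metric.infDist_le_dist_of_mem hc)

/-- Federer's inequality: a closest point within the reach `τ` is touched by a ball of radius
`τ` whose interior misses `M`. -/
theorem IsNearestPoint.inner_le_of_lt_reach [FiniteDimensional ℝ E] (hM : IsCompact M) {τ : ℝ}
    (hτ : ENNReal.ofReal τ ≤ reach M) {z b : E} (hb : IsNearestPoint M z b)
    (hlt : ‖z - b‖ < τ) {c : E} (hc : c ∈ M) :
    2 * τ * inner ℝ (c - b) (z - b) ≤ ‖z - b‖ * ‖c - b‖ ^ 2 := by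
  rcases (norm_nonneg (z - b)).eq_or_lt with h0 | hpos
  · rw [norm_eq_zero.1 h0.symm]; simp
  set δ := ‖z - b‖ with hδ
  -- The open ball of radius t centred at b + (t/δ)(z - b) misses M. Expanding the square gives the
  -- bound with t in place of τ, and t tends to τ.
  have key : ∀ t ∈ Ioo δ τ, 2 * t * inner ℝ (c - b) (z - b) ≤ δ * ‖c - b‖ ^ 2 := by
    intro t ht
    have h1 := hb.le_norm_add_smul_sub hM hτ hpos (s := t - δ) (by linarith [ht.1])
      (by linarith [ht.2]) hc
    rw [← hδ] at h1
    have e : z + (t - δ) • (δ⁻¹ • (z - b)) - c = (t / δ) • (z - b) - (c - b) := by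
      have e1 : (t - δ) • (δ⁻¹ • (z - b)) = (t / δ) • (z - b) - (z - b) := by
        rw [smul_smul, sub_mul, mul_inv_cancel₀ hpos.ne', sub_smul, one_smul, div_eq_mul_inv]
      rw [e1]; abel
    rw [e] at h1
    have ht0 : 0 < t := hpos.trans ht.1
    have h2 : t ^ 2 ≤ ‖(t / δ) • (z - b) - (c - b)‖ ^ 2 := by
      gcongr; linarith
    rw [norm_sub_sq_real, norm_smul, ← hδ, Real.norm_of_nonneg (by positivity),
      div_mul_cancel₀ _ hpos.ne', inner_smul_left, real_inner_comm] at h2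
    simp only [conj_trivial] at h2
    have h3 : 2 * (t / δ * inner ℝ (c - b) (z - b)) ≤ ‖c - b‖ ^ 2 := by linarith
    calc 2 * t * inner ℝ (c - b) (z - b) = δ * (2 * (t / δ * inner ℝ (c - b) (z - b))) := by
          field_simp
      _ ≤ _ := by gcongr
  have hlim : Tendsto (fun t => 2 * t * inner ℝ (c - b) (z - b)) (𝓝[<] τ)
      (𝓝 (2 * τ * inner ℝ (c - b) (z - b))) :=
    (Continuous.tendsto (by fun_prop) τ).mono_left nhdsWithin_le_nhds
  refine le_of_tendsto hlim ?_
  filter_upwards [Ioo_mem_nhdsLT hlt] with t ht using key t ht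

/-- The metric projection is `2`-Lipschitz up to half the reach. -/
theorem IsNearestPoint.norm_sub_le_two_mul [FiniteDimensional ℝ E] (hM : IsCompact M) {τ : ℝ}
    (hτ0 : 0 < τ) (hτ : ENNReal.ofReal τ ≤ reach M) {z w a b : E} (ha : IsNearestPoint M z a)
    (hb : IsNearestPoint M w b) (hz : ‖z - a‖ ≤ τ / 2) (hw : ‖w - b‖ ≤ τ / 2) :
    ‖b - a‖ ≤ 2 * ‖w - z‖ := by
  have h1 := ha.inner_le_of_lt_reach hM hτ (by linarith) hb.1
  have h2 := hb.inner_le_of_lt_reach hM hτ (by linarith) ha.1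
  have h1' : inner ℝ (b - a) (z - a) ≤ ‖b - a‖ ^ 2 / 4 := by
    have : ‖z - a‖ * ‖b - a‖ ^ 2 ≤ τ / 2 * ‖b - a‖ ^ 2 := by gcongr
    refine le_of_mul_le_mul_left ?_ (by positivity : 0 < 2 * τ)
    linarith
  have h2' : inner ℝ (a - b) (w - b) ≤ ‖b - a‖ ^ 2 / 4 := by
    have : ‖w - b‖ * ‖a - b‖ ^ 2 ≤ τ / 2 * ‖a - b‖ ^ 2 := by gcongr
    rw [norm_sub_rev a b] at this h2
    refine le_of_mul_le_mul_left ?_ (by positivity : 0 < 2 * τ)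
    linarith
  -- The two Federer inequalities add up to ‖b - a‖² - ⟨b - a, w - z⟩ ≤ ‖b - a‖² / 2.
  have e : inner ℝ (b - a) (z - a) + inner ℝ (a - b) (w - b)
      = ‖b - a‖ ^ 2 - inner ℝ (b - a) (w - z) := by
    have e1 : inner ℝ (a - b) (w - b) = - inner ℝ (b - a) (w - b) := by
      rw [← neg_sub b a, inner_neg_left]
    have e2 : z - a = (w - b) + (b - a) - (w - z) := by abel
    rw [e1, e2, inner_sub_right, inner_add_right, real_inner_self_eq_norm_sq]; ring
  have h3 := real_inner_le_norm (b - a) (w - z)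
  rcases (norm_nonneg (b - a)).eq_or_lt with h0 | hpos
  · rw [← h0]; positivity
  · refine le_of_mul_le_mul_left ?_ hpos
    nlinarith

end Reach

/-! ### Quantitative control of tangent spaces by the reach. -/

section TangentSpaces

variable {E : Type*} [NormedAddCommGroup E] [InnerProductSpace ℝ E] [FiniteDimensional ℝ E]
  {M : Set E} {k : ℕ} {τ : ℝ}

/-- Federer's bound on the distance from a point of `M` to a tangent space of `M`. -/
theorem IsC2Submanifold.norm_normal_sub_le (h : IsC2Submanifold k M) (hM : IsCompact M)
    (hτ0 : 0 < τ) (hτ : ENNReal.ofReal τ ≤ reach M) {a c : E} (ha : a ∈ M) (hc : c ∈ M) :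
    ‖(tangentSpaceAt M a)ᗮ.starProjection (c - a)‖ ≤ ‖c - a‖ ^ 2 / (2 * τ) := by
  obtain ⟨K, hK, r, hr, hquad⟩ := h.exists_quadratic_bound ha
  set T := tangentSpaceAt M a
  set D := ‖c - a‖ with hD
  have hD0 : 0 ≤ D := norm_nonneg _
  -- Federer's inequality is applied at the closest point p to a + t(c - a), which avoids showing
  -- that every normal direction at a is realized by a closest point. The residual n is at most
  -- about t D²/(2τ), and p - a is tangent at a up to O(t²). Dividing by t and letting t → 0 leaves
  -- the claim.
  have key : ∀ᶠ t in 𝓝[>] (0 : ℝ),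
      2 * τ * ‖Tᗮ.starProjection (c - a)‖ ≤ D ^ 2 + t * D ^ 2 + 8 * τ * K * t * D ^ 2 := by
    have e1 : ∀ᶠ t in 𝓝[>] (0 : ℝ), t * D < τ ∧ 2 * (t * D) < r ∧ t < 1 := by
      refine ((Continuous.tendsto' (by fun_prop) _ _ (by simp)).eventually_lt_const hτ0).and
        (((Continuous.tendsto' (by fun_prop) _ _ (by simp)).eventually_lt_const hr).and
        (tendsto_id.eventually_lt_const one_pos)) |>.filter_mono nhdsWithin_le_nhds
    filter_upwards [e1, self_mem_nhdsWithin] with t ⟨ht1, ht2, ht3⟩ ht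
    rw [mem_Ioi] at ht
    obtain ⟨p, hp⟩ := hM.exists_isNearestPoint ⟨a, ha⟩ (a + t • (c - a))
    set n := a + t • (c - a) - p with hn
    have hnD : ‖n‖ ≤ t * D := by
      have := hp.2 a ha
      rwa [dist_eq_norm, dist_eq_norm, add_sub_cancel_left, norm_smul,
        Real.norm_of_nonneg ht.le] at this
    have i1 := hp.inner_le_of_lt_reach hM hτ (hnD.trans_lt ht1) ha
    have i2 := hp.inner_le_of_lt_reach hM hτ (hnD.trans_lt ht1) hc
    rw [← hn] at i1 i2
    have hcomb : n = (1 - t) • (a - p) + t • (c - p) := by rw [hn]; module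
    have hnn : ‖n‖ ^ 2 = (1 - t) * inner ℝ (a - p) n + t * inner ℝ (c - p) n := by
      rw [← real_inner_self_eq_norm_sq]
      nth_rw 1 [hcomb]
      rw [inner_add_left, inner_smul_left, inner_smul_left]; simp
    have hst : (1 - t) * ‖a - p‖ ^ 2 + t * ‖c - p‖ ^ 2 = ‖n‖ ^ 2 + t * (1 - t) * D ^ 2 := by
      have e : c - a = (c - p) - (a - p) := by abel
      rw [hD, e, norm_sub_sq_real (c - p) (a - p), hcomb, norm_add_sq_real, inner_smul_left, inner_smul_right,
        norm_smul, norm_smul, Real.norm_of_nonneg ht.le, Real.norm_of_nonneg (by linarith),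
        real_inner_comm (a - p) (c - p)]
      simp only [conj_trivial]; ring
    -- The inequalities for a and c, weighted by 1 - t and t, combine because n is the same convex
    -- combination of a - p and c - p.
    have i3 : 2 * τ * ‖n‖ ^ 2 ≤ ‖n‖ * (‖n‖ ^ 2 + t * (1 - t) * D ^ 2) := by
      rw [← hst, hnn]
      have := mul_le_mul_of_nonneg_left i1 (by linarith : 0 ≤ 1 - t)
      have := mul_le_mul_of_nonneg_left i2 ht.le
      linarith
    have i4 : 2 * τ * ‖n‖ ≤ t * (t * D ^ 2 + D ^ 2) := by
      rcases (norm_nonneg n).eq_or_lt with h0 | hpos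
      · rw [← h0]; simp; positivity
      · have : 2 * τ * ‖n‖ ≤ ‖n‖ ^ 2 + t * (1 - t) * D ^ 2 := by
          refine le_of_mul_le_mul_left ?_ hpos; linarith
        have h5 : ‖n‖ ^ 2 ≤ (t * D) ^ 2 := by gcongr
        nlinarith [mul_nonneg ht.le (mul_nonneg ht.le (sq_nonneg D))]
    have hpa : ‖p - a‖ ≤ 2 * (t * D) := by
      have e : p - a = t • (c - a) - n := by rw [hn]; abel
      rw [e]
      refine (norm_sub_le _ _).trans ?_
      rw [norm_smul, Real.norm_of_nonneg ht.le]; linarith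
    obtain ⟨v, hv, hvp⟩ := hquad a ha p hp.1 (by rwa [dist_self]) (by
      rw [dist_eq_norm]; linarith)
    have i5 : ‖Tᗮ.starProjection (p - a)‖ ≤ K * (2 * (t * D)) ^ 2 :=
      (norm_starProjection_orthogonal_le_norm_sub T _ hv).trans (hvp.trans (by gcongr))
    have i6 : t * ‖Tᗮ.starProjection (c - a)‖ ≤ ‖n‖ + K * (2 * (t * D)) ^ 2 := by
      have e : t • (c - a) = n + (p - a) := by rw [hn]; abel
      calc t * ‖Tᗮ.starProjection (c - a)‖ = ‖Tᗮ.starProjection (t • (c - a))‖ := by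
            rw [map_smul, norm_smul, Real.norm_of_nonneg ht.le]
        _ ≤ ‖Tᗮ.starProjection n‖ + ‖Tᗮ.starProjection (p - a)‖ := by
            rw [e]; exact norm_starProjection_orthogonal_add_le _ _ _
        _ ≤ _ := add_le_add (Submodule.norm_starProjection_apply_le _ _) i5
    refine le_of_mul_le_mul_left ?_ ht
    have := mul_le_mul_of_nonneg_left i6 (by positivity : 0 ≤ 2 * τ)
    linarith
  have hlim : Tendsto (fun t : ℝ => D ^ 2 + t * D ^ 2 + 8 * τ * K * t * D ^ 2) (𝓝[>] 0)
      (𝓝 (D ^ 2)) :=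
    (Continuous.tendsto' (by fun_prop) _ _ (by simp)).mono_left nhdsWithin_le_nhds
  rw [le_div_iff₀ (by positivity), mul_comm]
  exact ge_of_tendsto hlim key

/-- A tangent vector u' at x of length s = ‖p - x‖ is the tangential part of q - x for some q ∈ M.
The three secants q - x, q - p and x - p are tangent at their base points up to O(s²/τ), so u' is
nearly tangent at p. The rate is explicit; only the radius R depends on x. -/
theorem IsC2Submanifold.exists_local_gap_bound (h : IsC2Submanifold k M) (hM : IsCompact M)
    (hτ0 : 0 < τ) (hτ : ENNReal.ofReal τ ≤ reach M) {x : E} (hx : x ∈ M) :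
    ∃ R > 0, ∀ p ∈ M, ‖p - x‖ < R → ∀ u ∈ tangentSpaceAt M x,
      ‖(tangentSpaceAt M p)ᗮ.starProjection u‖ ≤ 7 * ‖p - x‖ / τ * ‖u‖ := by
  obtain ⟨R, hR, H⟩ := h.exists_mem_of_small_tangent hx hτ0
  refine ⟨R, hR, fun p hp hpR u hu => ?_⟩
  set T := tangentSpaceAt M x
  set s := ‖p - x‖ with hs
  rcases (norm_nonneg (p - x)).eq_or_lt with h0 | hspos
  · have hpx : p = x := sub_eq_zero.1 (norm_eq_zero.1 h0.symm)
    have := norm_starProjection_orthogonal_le_norm_sub (tangentSpaceAt M p) u (v := u)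
      (hpx ▸ hu)
    rw [sub_self, norm_zero] at this
    exact this.trans (by positivity)
  rcases (norm_nonneg u).eq_or_lt with h0 | hupos
  · rw [norm_eq_zero.1 h0.symm]; simp
  rw [← hs] at hspos
  set u' := (s / ‖u‖) • u with hu'
  have hu'n : ‖u'‖ = s := by
    rw [hu', norm_smul, Real.norm_of_nonneg (by positivity), div_mul_cancel₀ _ hupos.ne']
  obtain ⟨q, hq, hqτ, hqu⟩ := H u' (T.smul_mem _ hu) (by rwa [hu'n])
  rw [dist_eq_norm] at hqτ
  have he : ‖q - x - u'‖ ≤ ‖q - x‖ ^ 2 / (2 * τ) := by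
    rw [← hqu, ← Submodule.starProjection_orthogonal_val]
    exact h.norm_normal_sub_le hM hτ0 hτ hx hq
  have hq2 : ‖q - x‖ ≤ 2 * s := by
    have h1 : ‖q - x‖ ≤ ‖u'‖ + ‖q - x - u'‖ := by
      have := norm_add_le u' (q - x - u'); rwa [add_sub_cancel] at this
    have h2 : ‖q - x‖ ^ 2 / (2 * τ) ≤ ‖q - x‖ / 2 := by
      rw [div_le_div_iff₀ (by positivity) (by norm_num)]
      nlinarith [norm_nonneg (q - x)]
    linarith
  have he' : ‖q - x - u'‖ ≤ (2 * s) ^ 2 / (2 * τ) := he.trans (by gcongr)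
  have hqp : ‖(tangentSpaceAt M p)ᗮ.starProjection (q - p)‖ ≤ (3 * s) ^ 2 / (2 * τ) := by
    refine (h.norm_normal_sub_le hM hτ0 hτ hp hq).trans ?_
    have : ‖q - p‖ ≤ 3 * s := by
      have h1 : q - p = (q - x) - (p - x) := by abel
      rw [h1]
      exact (norm_sub_le _ _).trans (by linarith)
    gcongr
  have hxp : ‖(tangentSpaceAt M p)ᗮ.starProjection (x - p)‖ ≤ s ^ 2 / (2 * τ) := by
    have := h.norm_normal_sub_le hM hτ0 hτ hp hx
    rwa [norm_sub_rev x p] at this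
  have hu'p : ‖(tangentSpaceAt M p)ᗮ.starProjection u'‖ ≤ 7 * s / τ * s := by
    have e : u' = ((q - p) - (x - p)) - (q - x - u') := by abel
    calc _ = ‖(tangentSpaceAt M p)ᗮ.starProjection (((q - p) - (x - p)) - (q - x - u'))‖ := by
            rw [← e]
      _ ≤ (‖(tangentSpaceAt M p)ᗮ.starProjection (q - p)‖
            + ‖(tangentSpaceAt M p)ᗮ.starProjection (x - p)‖)
            + ‖(tangentSpaceAt M p)ᗮ.starProjection (q - x - u')‖ := by
          refine (norm_starProjection_orthogonal_sub_le _ _ _).trans ?_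
          gcongr
          exact norm_starProjection_orthogonal_sub_le _ _ _
      _ ≤ ((3 * s) ^ 2 / (2 * τ) + s ^ 2 / (2 * τ)) + (2 * s) ^ 2 / (2 * τ) := by
          gcongr
          exact (Submodule.norm_starProjection_apply_le _ _).trans he'
      _ = 7 * s / τ * s := by field_simp; norm_num
  rw [hu', map_smul, norm_smul, Real.norm_of_nonneg (by positivity), div_mul_eq_mul_div,
    div_le_iff₀ hupos] at hu'p
  refine le_of_mul_le_mul_left ?_ hspos
  linarith

/-- The tangent spaces of `M` vary at a rate bounded by the inverse of the reach. -/
theorem IsC2Submanifold.norm_normal_tangent_le (h : IsC2Submanifold k M) (hM : IsCompact M)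
    (hτ0 : 0 < τ) (hτ : ENNReal.ofReal τ ≤ reach M) {x y : E} (hx : x ∈ M) (hy : y ∈ M)
    (hxy : ‖y - x‖ ≤ τ) {u : E} (hu : u ∈ tangentSpaceAt M x) :
    ‖(tangentSpaceAt M y)ᗮ.starProjection u‖ ≤ 14 * ‖y - x‖ / τ * ‖u‖ := by
  set D := ‖y - x‖ with hD
  choose P hP using hM.exists_isNearestPoint ⟨x, hx⟩
  have hfix : ∀ z ∈ M, P z = z := fun z hz => by
    have := (hP z).2 z hz
    rw [dist_self] at this
    exact (dist_le_zero.1 this).symm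
  -- The segment from x to y stays within τ/2 of M, so its projection to M is a path of speed at
  -- most 2D. Integrating the local rate 7/τ along it removes the dependence on R and gives 14 D/τ.
  set γ : ℝ → E := fun t => P (x + t • (y - x)) with hγ
  have hγ0 : γ 0 = x := by simp [hγ, hfix x hx]
  have hγ1 : γ 1 = y := by simp [hγ, hfix y hy]
  have hhalf : ∀ t ∈ Icc (0 : ℝ) 1, ‖x + t • (y - x) - γ t‖ ≤ τ / 2 := by
    intro t ht
    rw [← dist_eq_norm]
    rcases le_total t (1 / 2) with h1 | h1
    · refine ((hP _).2 x hx).trans ?_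
      rw [dist_eq_norm, add_sub_cancel_left, norm_smul, Real.norm_of_nonneg ht.1, ← hD]
      have := mul_le_mul_of_nonneg_right h1 (norm_nonneg (y - x))
      linarith
    · refine ((hP _).2 y hy).trans ?_
      have e : x + t • (y - x) - y = (t - 1) • (y - x) := by module
      rw [dist_eq_norm, e, norm_smul, Real.norm_of_nonpos (by linarith [ht.2]), ← hD]
      have := mul_le_mul_of_nonneg_right h1 (norm_nonneg (y - x))
      linarith
  have hlip : ∀ s ∈ Icc (0 : ℝ) 1, ∀ t ∈ Icc (0 : ℝ) 1, ‖γ s - γ t‖ ≤ 2 * (|s - t| * D) := by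
    intro s hs t ht
    have := (hP (x + t • (y - x))).norm_sub_le_two_mul hM hτ0 hτ (hP (x + s • (y - x)))
      (hhalf t ht) (hhalf s hs)
    rwa [add_sub_add_left_eq_sub, ← sub_smul, norm_smul, Real.norm_eq_abs] at this
  set g : ℝ → ℝ := fun t => ‖(tangentSpaceAt M (γ t))ᗮ.starProjection u‖ with hg
  set L := 14 * D / τ * ‖u‖ with hL
  have hL0 : 0 ≤ L := by positivity
  have hloc : ∀ t ∈ Icc (0 : ℝ) 1, ∃ ρ > 0, ∀ s ∈ Icc (0 : ℝ) 1, |s - t| < ρ →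
      |g s - g t| ≤ L * |s - t| := by
    intro t ht
    obtain ⟨R, hR, H⟩ := h.exists_local_gap_bound hM hτ0 hτ (hP (x + t • (y - x))).1
    -- The bound τ/8 keeps β below 1, so the gap can be reversed and `g` is controlled in both
    -- directions.
    set R' := min R (τ / 8) with hR'
    have hR'0 : 0 < R' := lt_min hR (by positivity)
    refine ⟨R' / (2 * D + 1), by positivity, fun s hs hst => ?_⟩
    have h1 := hlip s hs t ht
    have h2 : ‖γ s - γ t‖ < R' := by
      rw [lt_div_iff₀ (by positivity)] at hst
      nlinarith [abs_nonneg (s - t)]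
    set β := 7 * ‖γ s - γ t‖ / τ with hβ
    have hβ0 : 0 ≤ β := by positivity
    have hβ1 : β < 1 := by
      rw [hβ, div_lt_one hτ0]
      linarith [min_le_right R (τ / 8)]
    have g1 := H (γ s) (hP _).1 (h2.trans_le (min_le_left _ _))
    have g2 : ∀ v ∈ tangentSpaceAt M (γ s),
        ‖(tangentSpaceAt M (γ t))ᗮ.starProjection v‖ ≤ β * ‖v‖ := fun v hv =>
      norm_starProjection_orthogonal_symm
        ((h.finrank_tangentSpaceAt (hP _).1).trans (h.finrank_tangentSpaceAt (hP _).1).symm)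
        hβ1 g1 hv
    have k1 : g s ≤ g t + β * ‖u‖ := norm_starProjection_orthogonal_trans g1 hβ0
    have k2 : g t ≤ g s + β * ‖u‖ := norm_starProjection_orthogonal_trans g2 hβ0
    have k3 : β * ‖u‖ ≤ L * |s - t| := by
      have : β ≤ 14 * D / τ * |s - t| := by
        rw [hβ, div_mul_eq_mul_div]
        exact div_le_div_of_nonneg_right (by linarith) hτ0.le
      calc β * ‖u‖ ≤ 14 * D / τ * |s - t| * ‖u‖ := by gcongr
        _ = _ := by rw [hL]; ring
    rw [abs_le]; constructor <;> linarith
  have hcont : ContinuousOn g (Icc 0 1) := by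
    intro t ht
    obtain ⟨ρ, hρ, H⟩ := hloc t ht
    rw [Metric.continuousWithinAt_iff]
    intro e he
    refine ⟨min ρ (e / (L + 1)), lt_min hρ (by positivity), fun {s} hs hst => ?_⟩
    rw [Real.dist_eq] at hst ⊢
    refine (H s hs (hst.trans_le (min_le_left _ _))).trans_lt ?_
    have := hst.trans_le (min_le_right _ _)
    rw [lt_div_iff₀ (by positivity)] at this
    nlinarith [abs_nonneg (s - t)]
  have hg0 : g 0 ≤ L * 0 := by
    have := norm_starProjection_orthogonal_le_norm_sub (tangentSpaceAt M (γ 0)) u (v := u)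
      (hγ0.symm ▸ hu)
    rw [mul_zero]
    simpa only [sub_self, norm_zero] using this
  have hfin := image_le_of_liminf_slope_right_le_deriv_boundary (f := g) (a := 0) (b := 1)
    hcont (B := fun t => L * t) (B' := fun _ => L) hg0 (by fun_prop)
    (fun t _ => by simpa using ((hasDerivAt_id t).const_mul L).hasDerivWithinAt)
    (by
      intro t ht r hr
      obtain ⟨ρ, hρ, H⟩ := hloc t ⟨ht.1, ht.2.le⟩
      refine Eventually.frequently ?_
      filter_upwards [Ioo_mem_nhdsGT (show t < min 1 (t + ρ) from lt_min ht.2 (by linarith))]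
        with s hs
      have hs1 := hs.2.trans_le (min_le_left _ _)
      have hs2 := hs.2.trans_le (min_le_right _ _)
      have hpos : 0 < s - t := sub_pos.2 hs.1
      have := H s ⟨ht.1.trans hs.1.le, hs1.le⟩ (by rw [abs_of_pos hpos]; linarith)
      rw [abs_of_pos hpos] at this
      rw [slope_def_field, div_lt_iff₀ hpos]
      have h1 := (le_abs_self _).trans this
      nlinarith)
    (x := 1) ⟨zero_le_one, le_rfl⟩
  simpa [hg, hγ1] using hfin

/-- `M` contains a point quadratically close to any given small tangent displacement. -/
theorem IsC2Submanifold.exists_norm_add_sub_le (h : IsC2Submanifold k M) (hM : IsCompact M)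
    (hτ0 : 0 < τ) (hτ : ENNReal.ofReal τ ≤ reach M) {x : E} (hx : x ∈ M) {u : E}
    (hu : u ∈ tangentSpaceAt M x) (huτ : ‖u‖ ≤ τ / 2) :
    ∃ p ∈ M, ‖x + u - p‖ ≤ 30 * ‖u‖ ^ 2 / τ := by
  obtain ⟨p, hp⟩ := hM.exists_isNearestPoint ⟨x, hx⟩ (x + u)
  refine ⟨p, hp.1, ?_⟩
  have h1 : ‖x + u - p‖ ≤ ‖u‖ := by simpa [dist_eq_norm] using hp.2 x hx
  have h2 : ‖p - x‖ ≤ 2 * ‖u‖ := by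
    have e : p - x = u - (x + u - p) := by abel
    rw [e]
    exact (norm_sub_le _ _).trans (by linarith)
  -- The residual is normal at p, so only the normal parts of x - p and of u count; they contribute
  -- 2 and 28 to the constant 30.
  have e : x + u - p = (x - p) + u := by abel
  calc ‖x + u - p‖ = ‖(tangentSpaceAt M p)ᗮ.starProjection (x + u - p)‖ := by
        rw [h.starProjection_orthogonal_of_isNearestPoint hp]
    _ ≤ ‖(tangentSpaceAt M p)ᗮ.starProjection (x - p)‖
        + ‖(tangentSpaceAt M p)ᗮ.starProjection u‖ := by
        rw [e]; exact norm_starProjection_orthogonal_add_le _ _ _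
    _ ≤ (2 * ‖u‖) ^ 2 / (2 * τ) + 14 * (2 * ‖u‖) / τ * ‖u‖ := by
        gcongr
        · refine (h.norm_normal_sub_le hM hτ0 hτ hp.1 hx).trans ?_
          rw [norm_sub_rev]; gcongr
        · refine (h.norm_normal_tangent_le hM hτ0 hτ hx hp.1 (by linarith) hu).trans ?_
          gcongr
    _ = _ := by field_simp; ring

end TangentSpaces

/-! ### From gaps to principal angles. -/

section Angle

variable {E : Type*} [NormedAddCommGroup E] [InnerProductSpace ℝ E] [FiniteDimensional ℝ E]

/-- The angle between u and its projection to T' has sine at most θ. Jordan's inequality bounds it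
by πθ/2, and π ≤ 4. If the projection is 0, then θ ≥ 1 and the angle π/2 is still at most 2θ. -/
theorem maxPrincipalAngle_le {T T' : Submodule ℝ E} {θ : ℝ} (hθ : 0 ≤ θ)
    (h : ∀ u ∈ T, ‖T'ᗮ.starProjection u‖ ≤ θ * ‖u‖) : maxPrincipalAngle T T' ≤ 2 * θ := by
  refine Real.iSup_le (fun ⟨u, hu, hu0⟩ => ?_) (by positivity)
  have hupos : 0 < ‖u‖ := norm_pos_iff.2 hu0
  set v := T'.starProjection u with hv
  set w := T'ᗮ.starProjection u with hw
  have huvw : v + w = u := by rw [hv, hw, Submodule.starProjection_orthogonal_val]; abel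
  have hvT : v ∈ T' := Submodule.starProjection_apply_mem _ _
  have horth : inner ℝ v w = 0 :=
    (Submodule.mem_orthogonal _ _).1 (Submodule.starProjection_apply_mem T'ᗮ u) v hvT
  refine (ciInf_le ⟨0, ?_⟩ (⟨v, hvT⟩ : T')).trans ?_
  · rintro _ ⟨v', rfl⟩
    exact InnerProductGeometry.angle_nonneg _ _
  change InnerProductGeometry.angle u v ≤ _
  have hle := h u hu
  rw [← hw] at hle
  have hpi := Real.pi_le_four
  rcases eq_or_ne v 0 with hv0 | hv0
  · rw [hv0, InnerProductGeometry.angle_zero_right]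
    rw [hv0, zero_add] at huvw
    rw [huvw] at hle
    have : 1 ≤ θ := by
      refine le_of_mul_le_mul_right ?_ hupos
      linarith
    linarith
  · have hang := InnerProductGeometry.angle_add_eq_arcsin_of_inner_eq_zero horth (Or.inl hv0)
    rw [huvw] at hang
    rw [InnerProductGeometry.angle_comm, hang]
    set t := ‖w‖ / ‖u‖ with ht
    have ht0 : 0 ≤ t := by positivity
    have ht1 : t ≤ 1 := (div_le_one hupos).2 (Submodule.norm_starProjection_apply_le _ _)
    have htθ : t ≤ θ := (div_le_iff₀ hupos).2 hle
    have hsin := Real.mul_le_sin (Real.arcsin_nonneg.2 ht0) (Real.arcsin_le_pi_div_two t)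
    rw [Real.sin_arcsin (by linarith) ht1, div_mul_eq_mul_div, div_le_iff₀ Real.pi_pos] at hsin
    nlinarith

end Angle

/-! ### Comparison of two submanifolds through a common net. -/

section Comparison

variable {E : Type*} [NormedAddCommGroup E] [InnerProductSpace ℝ E] [FiniteDimensional ℝ E]
  {M S : Set E} {k n : ℕ} {x : Fin n → E} {ε τ : ℝ}

/-- At a common net point, the tangent spaces of two submanifolds of large reach are close. -/
theorem norm_normal_tangent_le_of_net (hM : IsC2Submanifold k M) (hMc : IsCompact M)
    (hS : IsC2Submanifold k S) (hSc : IsCompact S) (hτ0 : 0 < τ)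
    (hτM : ENNReal.ofReal τ ≤ reach M) (hτS : ENNReal.ofReal τ ≤ reach S)
    (hxM : ∀ i, x i ∈ M) (hxS : ∀ i, x i ∈ S) (hcov : ∀ p ∈ M, ∃ i, dist p (x i) ≤ ε)
    (hε : 0 < ε) (hετ : 480 * ε ≤ τ) (i : Fin n) {u : E} (hu : u ∈ tangentSpaceAt M (x i)) :
    ‖(tangentSpaceAt S (x i))ᗮ.starProjection u‖ ≤ 18 * ε / τ * ‖u‖ := by
  set T := tangentSpaceAt M (x i)
  set T' := tangentSpaceAt S (x i)
  -- The norm of A is the gap from T to T'. It is finite a priori, so bounding it by 9ε/τ plus half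
  -- of itself suffices.
  set A : E →L[ℝ] E := T'ᗮ.starProjection.comp T.starProjection with hA
  have hAle : ‖A‖ ≤ 9 * ε / τ + ‖A‖ / 2 := by
    refine A.opNorm_le_bound (by positivity) fun w => ?_
    set u := T.starProjection w with hu
    have huT : u ∈ T := Submodule.starProjection_apply_mem _ _
    have huw : ‖u‖ ≤ ‖w‖ := Submodule.norm_starProjection_apply_le _ _
    have hAw : A w = T'ᗮ.starProjection u := rfl
    rw [hAw]
    refine le_trans ?_ (mul_le_mul_of_nonneg_left huw (by positivity))
    rcases (norm_nonneg u).eq_or_lt with h0 | hupos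
    · rw [norm_eq_zero.1 h0.symm]; simp
    -- Length 4ε is twice the net error 2ε, which produces the factor 1/2. It also explains 480 = 30
    -- · 4²: the lift of u' to M is then off by at most ε.
    set u' := (4 * ε / ‖u‖) • u with hu'
    have hu'n : ‖u'‖ = 4 * ε := by
      rw [hu', norm_smul, Real.norm_of_nonneg (by positivity), div_mul_cancel₀ _ hupos.ne']
    obtain ⟨p, hp, hpu⟩ := hM.exists_norm_add_sub_le hMc hτ0 hτM (hxM i) (T.smul_mem _ huT)
      (by rw [← hu', hu'n]; linarith)
    rw [← hu', hu'n] at hpu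
    obtain ⟨j, hj⟩ := hcov p hp
    rw [dist_eq_norm] at hj
    have hpε : ‖x i + u' - p‖ ≤ ε := by
      refine hpu.trans ?_
      rw [div_le_iff₀ hτ0]
      nlinarith
    set e := x j - x i - u' with he
    have hen : ‖e‖ ≤ 2 * ε := by
      have : e = -((x i + u' - p) + (p - x j)) := by rw [he]; abel
      rw [this, norm_neg]
      exact (norm_add_le _ _).trans (by linarith)
    have hd : ‖x j - x i‖ ≤ 6 * ε := by
      have : x j - x i = u' + e := by rw [he]; abel
      rw [this]
      exact (norm_add_le _ _).trans (by linarith)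
    have b1 : ‖Tᗮ.starProjection (x j - x i)‖ ≤ (6 * ε) ^ 2 / (2 * τ) :=
      (hM.norm_normal_sub_le hMc hτ0 hτM (hxM i) (hxM j)).trans (by gcongr)
    have b2 : ‖T'ᗮ.starProjection (x j - x i)‖ ≤ (6 * ε) ^ 2 / (2 * τ) :=
      (hS.norm_normal_sub_le hSc hτ0 hτS (hxS i) (hxS j)).trans (by gcongr)
    have b3 : ‖A e‖ ≤ ‖A‖ * (2 * ε) := (A.le_opNorm e).trans (by gcongr)
    -- Projecting the error e to T lets it enter only through A. The other two terms are normal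
    -- parts of the secant x j - x i, each of size at most 18ε²/τ.
    have hdec : u' = (x j - x i) - Tᗮ.starProjection (x j - x i) - T.starProjection e := by
      have h1 : T.starProjection u' = u' :=
        Submodule.starProjection_eq_self_iff.2 (T.smul_mem _ huT)
      rw [Submodule.starProjection_orthogonal_val, he, map_sub T.starProjection (x j - x i), h1]
      abel
    have hu'b : ‖T'ᗮ.starProjection u'‖ ≤ 36 * ε ^ 2 / τ + ‖A‖ * (2 * ε) := by
      rw [hdec]
      calc _ ≤ (‖T'ᗮ.starProjection (x j - x i)‖
              + ‖T'ᗮ.starProjection (Tᗮ.starProjection (x j - x i))‖) + ‖A e‖ := by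
            refine (norm_starProjection_orthogonal_sub_le _ _ _).trans ?_
            exact add_le_add (norm_starProjection_orthogonal_sub_le _ _ _) le_rfl
        _ ≤ ((6 * ε) ^ 2 / (2 * τ) + (6 * ε) ^ 2 / (2 * τ)) + ‖A‖ * (2 * ε) := by
            gcongr
            exact (Submodule.norm_starProjection_apply_le _ _).trans b1
        _ = _ := by field_simp; ring
    rw [hu', map_smul, norm_smul, Real.norm_of_nonneg (by positivity), div_mul_eq_mul_div,
      div_le_iff₀ hupos] at hu'b
    refine le_of_mul_le_mul_left (hu'b.trans (le_of_eq ?_)) (by positivity : 0 < 4 * ε)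
    field_simp; ring
  have hAle' : ‖A‖ ≤ 18 * ε / τ := by
    have : 18 * ε / τ = 2 * (9 * ε / τ) := by ring
    linarith
  have hAu : A u = T'ᗮ.starProjection u := by
    rw [hA, ContinuousLinearMap.comp_apply, Submodule.starProjection_eq_self_iff.2 hu]
  rw [← hAu]
  exact (A.le_opNorm u).trans (by gcongr)

/-- The gap is chained from p to x i along M, across to S at x i, and on to s along S, for a total
of at most (14 · 3 + 18) ε/τ. The budget 3ε fits a closest point: it is within 2ε of a net point
that is within ε of the projected point. For τ < 480ε the bound exceeds 1 and is trivial. -/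
theorem norm_normal_tangent_le_of_near_net (hM : IsC2Submanifold k M) (hMc : IsCompact M)
    (hS : IsC2Submanifold k S) (hSc : IsCompact S) (hτ0 : 0 < τ)
    (hτM : ENNReal.ofReal τ ≤ reach M) (hτS : ENNReal.ofReal τ ≤ reach S)
    (hxM : ∀ i, x i ∈ M) (hxS : ∀ i, x i ∈ S) (hcov : ∀ p ∈ M, ∃ i, dist p (x i) ≤ ε)
    (hε : 0 < ε) (i : Fin n) {p s : E} (hp : p ∈ M) (hs : s ∈ S)
    (hps : dist p (x i) + dist s (x i) ≤ 3 * ε) {u : E} (hu : u ∈ tangentSpaceAt M p) :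
    ‖(tangentSpaceAt S s)ᗮ.starProjection u‖ ≤ 480 * ε / τ * ‖u‖ := by
  rcases lt_or_ge τ (480 * ε) with hlarge | hsmall
  · refine (Submodule.norm_starProjection_apply_le _ _).trans ?_
    have : 1 ≤ 480 * ε / τ := (one_le_div hτ0).2 hlarge.le
    nlinarith [norm_nonneg u]
  set a := dist p (x i) with ha
  set b := dist s (x i) with hb
  have ha0 : 0 ≤ a := dist_nonneg
  have hb0 : 0 ≤ b := dist_nonneg
  have ha' : ‖x i - p‖ = a := by rw [ha, dist_comm, dist_eq_norm]
  have hb' : ‖s - x i‖ = b := by rw [hb, dist_eq_norm]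
  have g1 := hM.norm_normal_tangent_le hMc hτ0 hτM hp (hxM i) (by rw [ha']; linarith) hu
  have g2 := fun v hv => norm_normal_tangent_le_of_net hM hMc hS hSc hτ0 hτM hτS hxM hxS hcov hε
    hsmall i (u := v) hv
  have g3 := fun v hv => hS.norm_normal_tangent_le hSc hτ0 hτS (hxS i) hs
    (by rw [hb']; linarith) (u := v) hv
  have k2 := norm_starProjection_orthogonal_trans g2 (by positivity) (u := u)
  have k3 := norm_starProjection_orthogonal_trans g3 (by positivity) (u := u)
  rw [ha'] at g1
  rw [hb'] at k3
  have hfin : (14 * a / τ + 18 * ε / τ + 14 * b / τ) * ‖u‖ ≤ 480 * ε / τ * ‖u‖ := by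
    gcongr
    rw [← add_div, ← add_div]
    exact div_le_div_of_nonneg_right (by linarith) hτ0.le
  linarith

theorem exists_dist_le_of_net (hM : IsC2Submanifold k M) (hMc : IsCompact M)
    (hS : IsC2Submanifold k S) (hSc : IsCompact S) (hτ0 : 0 < τ)
    (hτM : ENNReal.ofReal τ ≤ reach M) (hτS : ENNReal.ofReal τ ≤ reach S)
    (hxM : ∀ i, x i ∈ M) (hxS : ∀ i, x i ∈ S) (hcov : ∀ p ∈ M, ∃ i, dist p (x i) ≤ ε)
    (hε : 0 < ε) {p : E} (hp : p ∈ M) :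
    ∃ q ∈ S, dist p q ≤ 480 * ε ^ 2 / τ := by
  obtain ⟨i, hi⟩ := hcov p hp
  rcases lt_or_ge τ (480 * ε) with hlarge | hsmall
  · refine ⟨x i, hxS i, hi.trans ?_⟩
    rw [le_div_iff₀ hτ0]
    nlinarith
  rw [dist_eq_norm] at hi
  set T := tangentSpaceAt M (x i)
  set T' := tangentSpaceAt S (x i)
  set v := T.starProjection (p - x i) with hv
  set v' := T'.starProjection v with hv'
  have hvε : ‖v‖ ≤ ε := (Submodule.norm_starProjection_apply_le _ _).trans hi
  have hv'ε : ‖v'‖ ≤ ε := (Submodule.norm_starProjection_apply_le _ _).trans hvε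
  have b1 : ‖p - x i - v‖ ≤ ε ^ 2 / (2 * τ) := by
    rw [hv, ← Submodule.starProjection_orthogonal_val]
    exact (hM.norm_normal_sub_le hMc hτ0 hτM (hxM i) hp).trans (by gcongr)
  have b2 : ‖v - v'‖ ≤ 18 * ε / τ * ε := by
    rw [hv', ← Submodule.starProjection_orthogonal_val]
    exact (norm_normal_tangent_le_of_net hM hMc hS hSc hτ0 hτM hτS hxM hxS hcov hε hsmall i
      (Submodule.starProjection_apply_mem _ _)).trans (by gcongr)
  obtain ⟨q, hq, hqv⟩ := hS.exists_norm_add_sub_le hSc hτ0 hτS (hxS i)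
    (Submodule.starProjection_apply_mem T' v) (by rw [← hv']; linarith)
  rw [← hv'] at hqv
  refine ⟨q, hq, ?_⟩
  -- The three terms are the flattening of M, the gap between the tangent spaces, and the lift to S.
  have e : p - q = (p - x i - v) + (v - v') + (x i + v' - q) := by abel
  rw [dist_eq_norm, e]
  calc _ ≤ ‖p - x i - v‖ + ‖v - v'‖ + ‖x i + v' - q‖ := norm_add₃_le
    _ ≤ ε ^ 2 / (2 * τ) + 18 * ε / τ * ε + 30 * ε ^ 2 / τ := by
        gcongr
        exact hqv.trans (by gcongr)
    _ = (97 / 2 * ε ^ 2) / τ := by field_simp; ring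
    _ ≤ _ := by gcongr; norm_num

/-- The comparison of two submanifolds of reach at least `τ` through a common net. -/
theorem comparison_of_net (hM2 : IsC2Submanifold k M) (hMc : IsCompact M)
    (hS2 : IsC2Submanifold k S) (hSc : IsCompact S) (hτ0 : 0 < τ)
    (hτM : ENNReal.ofReal τ ≤ reach M) (hτS : ENNReal.ofReal τ ≤ reach S)
    (hxM : ∀ i, x i ∈ M) (hxS : ∀ i, x i ∈ S) (hcovM : ∀ p ∈ M, ∃ i, dist p (x i) ≤ ε)
    (hcovS : ∀ p ∈ S, ∃ i, dist p (x i) ≤ ε) (hε : 0 < ε) :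
    Metric.hausdorffDist M S ≤ 480 * ε ^ 2 / τ ∧
      (∀ p ∈ M, ∀ s, IsNearestPoint S p s →
        maxPrincipalAngle (tangentSpaceAt M p) (tangentSpaceAt S s) ≤ 960 * ε / τ) ∧
      (∀ a ∈ S, ∀ m, IsNearestPoint M a m →
        maxPrincipalAngle (tangentSpaceAt M m) (tangentSpaceAt S a) ≤ 960 * ε / τ) := by
  have e : 960 * ε / τ = 2 * (480 * ε / τ) := by ring
  refine ⟨Metric.hausdorffDist_le_of_mem_dist (by positivity)
    (fun p hp => exists_dist_le_of_net hM2 hMc hS2 hSc hτ0 hτM hτS hxM hxS hcovM hε hp)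
    (fun p hp => exists_dist_le_of_net hS2 hSc hM2 hMc hτ0 hτS hτM hxS hxM hcovS hε hp),
    fun p hp s hs => ?_, fun a ha m hm => ?_⟩
  · obtain ⟨i, hi⟩ := hcovM p hp
    rw [e]
    refine maxPrincipalAngle_le (by positivity) fun u hu =>
      norm_normal_tangent_le_of_near_net hM2 hMc hS2 hSc hτ0 hτM hτS hxM hxS hcovM hε i hp hs.1 ?_
        hu
    have h1 := hs.2 _ (hxS i)
    have h2 := dist_triangle s p (x i)
    rw [dist_comm s p] at h2
    linarith
  · obtain ⟨i, hi⟩ := hcovS a ha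
    rw [e]
    refine maxPrincipalAngle_le (by positivity) fun u hu =>
      norm_normal_tangent_le_of_near_net hM2 hMc hS2 hSc hτ0 hτM hτS hxM hxS hcovM hε i hm.1 ha ?_
        hu
    have h1 := hm.2 _ (hxM i)
    have h2 := dist_triangle m a (x i)
    rw [dist_comm m a] at h2
    linarith

/-- Covering at scale ε implies covering at every ε' > ε, so the case ε = 0 follows by letting ε'
decrease to ε. -/
theorem comparison_of_reach_le (hM : M ∈ surfaceClass k x ε) (hS : S ∈ surfaceClass k x ε)
    (hε : 0 ≤ ε) (hτ0 : 0 < τ) (hτM : ENNReal.ofReal τ ≤ reach M)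
    (hτS : ENNReal.ofReal τ ≤ reach S) :
    Metric.hausdorffDist M S ≤ 480 * ε ^ 2 / τ ∧
      (∀ p ∈ M, ∀ s, IsNearestPoint S p s →
        maxPrincipalAngle (tangentSpaceAt M p) (tangentSpaceAt S s) ≤ 960 * ε / τ) ∧
      (∀ a ∈ S, ∀ m, IsNearestPoint M a m →
        maxPrincipalAngle (tangentSpaceAt M m) (tangentSpaceAt S a) ≤ 960 * ε / τ) := by
  obtain ⟨hMc, -, hM2, hxM, hcovM, -⟩ := hM
  obtain ⟨hSc, -, hS2, hxS, hcovS, -⟩ := hS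
  have key := fun (ε' : ℝ) (h : ε < ε') =>
    comparison_of_net (ε := ε') hM2 hMc hS2 hSc hτ0 hτM hτS hxM hxS
      (fun p hp => (hcovM p hp).imp fun i hi => hi.trans h.le)
      (fun p hp => (hcovS p hp).imp fun i hi => hi.trans h.le) (hε.trans_lt h)
  have lim : ∀ (f : ℝ → ℝ) (X : ℝ), Continuous f → (∀ ε' > ε, X ≤ f ε') → X ≤ f ε :=
    fun f X hf H => ge_of_tendsto ((hf.tendsto ε).mono_left (nhdsWithin_le_nhds (s := Ioi ε)))
      (by filter_upwards [self_mem_nhdsWithin] with ε' h using H ε' h)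
  exact ⟨lim (fun e => 480 * e ^ 2 / τ) _ (by fun_prop) fun ε' h => (key ε' h).1,
    fun p hp s hs => lim (fun e => 960 * e / τ) _ (by fun_prop)
      fun ε' h => (key ε' h).2.1 p hp s hs,
    fun a ha m hm => lim (fun e => 960 * e / τ) _ (by fun_prop)
      fun ε' h => (key ε' h).2.2 a ha m hm⟩

end Comparison

/-! ### The choice of C and the medial axes. -/

theorem mainTheorem2 :
    ∃ C : ℝ≥0∞ → ℝ, ∀ (d k n : ℕ) (ε : ℝ) (x : Fin n → EuclideanSpace ℝ (Fin d))
      (M S : Set (EuclideanSpace ℝ (Fin d))),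
      M ∈ surfaceClass k x ε → S ∈ surfaceClass k x ε → maxReach k x ε / 2 ≤ reach S →
        Metric.hausdorffDist M S ≤ C (reach M) * ε ^ 2 ∧
        (∀ p ∈ M, ∀ s, IsNearestPoint S p s →
          maxPrincipalAngle (tangentSpaceAt M p) (tangentSpaceAt S s) ≤ C (reach M) * ε) ∧
        (∀ a ∈ S, ∀ m, IsNearestPoint M a m →
          maxPrincipalAngle (tangentSpaceAt M m) (tangentSpaceAt S a) ≤ C (reach M) * ε) ∧
        (ENNReal.ofReal (2 * ε) < reach M →
          (∀ p ∈ M, p ∉ medialAxis S) ∧ ∀ a ∈ S, a ∉ medialAxis M) := by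
  -- 1920/ρ is 960/τ with τ = ρ/2. For infinite reach the comparison holds for every τ, and τ → ∞
  -- leaves the constant 0.
  refine ⟨fun ρ => if ρ = ∞ then 0 else 1920 / ρ.toReal, fun d k n ε x M S hM hS hmax => ?_⟩
  have hε : 0 ≤ ε := by
    obtain ⟨p, hp⟩ := hM.2.1.nonempty
    obtain ⟨i, hi⟩ := hM.2.2.2.2.1 p hp
    exact dist_nonneg.trans hi
  have hMmax : reach M ≤ maxReach k x ε := le_iSup₂ (f := fun M _ => reach M) M hM
  have hhalf : reach M / 2 ≤ reach S := (ENNReal.div_le_div_right hMmax 2).trans hmax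
  -- Division by a zero reach would give C = 0, so positivity of the reach is essential here.
  have hpos : 0 < reach M := hM.2.2.1.reach_pos hM.1
  refine (and_assoc.trans (and_congr_right' and_assoc)).1 ⟨?_, fun hlt => ⟨?_, ?_⟩⟩
  · dsimp only
    split_ifs with htop
    · have hSr : reach S = ∞ := by
        rw [htop, ENNReal.top_div_of_ne_top (by norm_num)] at hhalf
        exact top_le_iff.1 hhalf
      have key := fun (τ : ℝ) (hτ : 0 < τ) => comparison_of_reach_le hM hS hε hτ
        (htop ▸ le_top) (hSr ▸ le_top)
      have lim : ∀ c X : ℝ, (∀ τ > 0, X ≤ c / τ) → X ≤ 0 := fun c X H =>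
        ge_of_tendsto (tendsto_const_nhds.div_atTop tendsto_id)
          (by filter_upwards [eventually_gt_atTop 0] with τ hτ using H τ hτ)
      rw [zero_mul, zero_mul]
      exact ⟨lim _ _ fun τ h => (key τ h).1,
        fun p hp s hs => lim _ _ fun τ h => (key τ h).2.1 p hp s hs,
        fun a ha m hm => lim _ _ fun τ h => (key τ h).2.2 a ha m hm⟩
    · have hρ : 0 < (reach M).toReal := ENNReal.toReal_pos hpos.ne' htop
      have hτ : ENNReal.ofReal ((reach M).toReal / 2) = reach M / 2 := by
        rw [ENNReal.ofReal_div_of_pos two_pos, ENNReal.ofReal_toReal htop, ENNReal.ofReal_ofNat]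
      obtain ⟨h1, h2, h3⟩ := comparison_of_reach_le hM hS hε (half_pos hρ)
        (hτ.trans_le ENNReal.half_le_self) (hτ.trans_le hhalf)
      have e : 960 * ε / ((reach M).toReal / 2) = 1920 / (reach M).toReal * ε := by
        field_simp; ring
      rw [e] at h2 h3
      refine ⟨h1.trans ?_, h2, h3⟩
      have e' : 480 * ε ^ 2 / ((reach M).toReal / 2) = 960 / (reach M).toReal * ε ^ 2 := by
        field_simp; ring
      rw [e']
      gcongr
      norm_num
  · intro p hp hax
    obtain ⟨i, hi⟩ := hM.2.2.2.2.1 p hp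
    -- The net point x i lies on S as well, so p in the medial axis of S bounds the reach of S by
    -- dist (x i) p ≤ ε.
    have h1 := hhalf.trans (reach_le_of_mem_medialAxis (hS.2.2.2.1 i) hax)
    have h2 : ENNReal.ofReal ε < reach M / 2 := by
      rw [ENNReal.lt_div_iff_mul_lt (by norm_num) (by norm_num), mul_comm]
      rwa [ENNReal.ofReal_mul two_pos.le, ENNReal.ofReal_ofNat] at hlt
    rw [dist_comm] at h1
    exact absurd (h2.trans_le (h1.trans (ENNReal.ofReal_le_ofReal hi))) (lt_irrefl _)
  · intro a ha hax
    obtain ⟨i, hi⟩ := hS.2.2.2.2.1 a ha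
    have h1 := reach_le_of_mem_medialAxis (hM.2.2.2.1 i) hax
    rw [dist_comm] at h1
    exact absurd (hlt.trans_le (h1.trans (ENNReal.ofReal_le_ofReal (hi.trans (by linarith)))))
      (lt_irrefl _)
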